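/- Let $T$ be a once-punctured torus; $\pi=\pi_1(T)$ is a free group of rank two. Let $\Omega$ be the set of isotopy classes of unoriented essential (i.e. neither null-homotopic nor boundary-parallel) simple closed curves in $T$. Equivalently, and this is how $\Omega$ is described here, an element $X\in\Omega$ is the union of the conjugacy classes of $g$ and $g^{-1}$, where $g\in\pi$ is primitive, i.e. belongs to a free basis $\{g,g'\}$ of $\pi$. For a representation $\rho:\pi\to\mathrm{SL}(2,\mathbb C)$ put $\operatorname{tr}\rho(X)=\operatorname{tr}\rho(g)$, which does not depend on the choice of $g$. Let $\{a,b\}$ be any free basis of $\pi$, let $\tau=\operatorname{tr}\rho(aba^{-1}b^{-1})$ be the peripheral trace of $\rho$, and let $\mu=\tau+2$. Let $\sqrt{\phantom{x}}$ be the complex square root with non-negative real part. **Theorem.** Suppose that $\rho$ is irreducible and satisfies the Bowditch conditions: (i) $\operatorname{tr}\rho(X)\notin[-2,2]\subset\mathbb R$ for all $X\in\Omega$; (ii) the set $\{X\in\Omega : |\operatorname{tr}\rho(X)|\le 2\}$ is finite (possibly empty). Then $(\operatorname{tr}\rho(X))^2\neq\mu$ for all $X\in\Omega$, and $$\sum_{X\in\Omega}h_\mu(\operatorname{tr}\rho(X))=\frac12,$$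 where the sum converges absolutely and $$h_\mu(x)=\frac12\left(1-\frac{x^2-\frac23\mu}{x^2-\mu}\sqrt{1-\frac4{x^2}}\right),\qquad x\in\mathbb C\setminus([-2,2]\cup\{\pm\sqrt\mu\}).$$ In particular, if $\mu=0$, this is Bowditch's identity $\sum_{X\in\Omega}\frac12\left(1-\sqrt{1-4/(\operatorname{tr}\rho(X))^2}\right)=\frac12$. -/

import Mathlib

open scoped MatrixGroups

noncomputable section

/-- The branch of the complex square root with values in `{z | 0 ≤ Re z}`. -/
def csqrt (z : ℂ) : ℂ := z ^ (1 / 2 : ℂ)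

theorem csqrt_sq (z : ℂ) : csqrt z ^ 2 = z := by
  unfold csqrt
  rw [one_div]
  exact Complex.cpow_ofNat_inv_pow z 2

theorem csqrt_re_nonneg (z : ℂ) : 0 ≤ (csqrt z).re := by
  unfold csqrt
  by_cases hz : z = 0
  · subst hz; simp
  · rw [Complex.cpow_def_of_ne_zero hz, Complex.exp_re]
    have him : (Complex.log z * (1 / 2)).im = z.arg / 2 := by
      rw [mul_one_div, ← Complex.log_im z]
      simp
    rw [him]
    refine mul_nonneg (Real.exp_pos _).le (Real.cos_nonneg_of_mem_Icc ⟨?_, ?_⟩)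
    · linarith [Complex.neg_pi_lt_arg z]
    · linarith [Complex.arg_le_pi z]

/-- `h_μ(x) = ½ (1 - (x² - ⅔ μ) / (x² - μ) · √(1 - 4 / x²))`, meaningful for
`x ∉ [-2, 2] ∪ {±√μ}`. -/
def hMu (μ x : ℂ) : ℂ :=
  1 / 2 * (1 - (x ^ 2 - 2 / 3 * μ) / (x ^ 2 - μ) * csqrt (1 - 4 / x ^ 2))

namespace PuncturedTorus

/-! Throughout, `π` is a group with a free basis of two elements: the fundamental group of a
once-punctured torus. -/

variable {π : Type*} [Group π]

/-- The elements of `π` that are a member of some free basis of two elements. -/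
def IsPrimitive (g : π) : Prop := ∃ (c : FreeGroupBasis (Fin 2) π) (i : Fin 2), c i = g

variable (π) in
/-- Two primitive elements represent the same unoriented closed curve, up to free homotopy, if
and only if each is conjugate to the other one or to its inverse. -/
def curveSetoid : Setoid {g : π // IsPrimitive g} where
  r g h := IsConj g.1 h.1 ∨ IsConj g.1 h.1⁻¹
  iseqv :=
    { refl := fun g => Or.inl (IsConj.refl g.1)
      symm := by
        have inv_conj : ∀ {a b : π}, IsConj a b → IsConj a⁻¹ b⁻¹ := by
          intro a b h
          obtain ⟨c, hc⟩ := isConj_iff.1 h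
          exact isConj_iff.2 ⟨c, by rw [← hc]; group⟩
        rintro g h (H | H)
        · exact Or.inl H.symm
        · have H2 := inv_conj H.symm
          rw [inv_inv] at H2
          exact Or.inr H2
      trans := by
        have inv_conj : ∀ {a b : π}, IsConj a b → IsConj a⁻¹ b⁻¹ := by
          intro a b h
          obtain ⟨c, hc⟩ := isConj_iff.1 h
          exact isConj_iff.2 ⟨c, by rw [← hc]; group⟩
        rintro g h k (H | H) (K | K)
        · exact Or.inl (H.trans K)
        · exact Or.inr (H.trans K)
        · exact Or.inr (H.trans (inv_conj K))
        · have K2 := inv_conj K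
          rw [inv_inv] at K2
          exact Or.inl (H.trans K2) }

variable (π) in
/-- The set `Ω` of (isotopy classes of unoriented) essential simple closed curves of the
once-punctured torus, each given by the union of the conjugacy classes of a primitive element of
`π` and of its inverse. -/
def Curves : Type _ := Quotient (curveSetoid π)

/-- The trace of `ρ(g)`. -/
def elementTrace (ρ : π →* SL(2, ℂ)) (g : π) : ℂ := (ρ g : Matrix (Fin 2) (Fin 2) ℂ).trace

theorem elementTrace_inv (ρ : π →* SL(2, ℂ)) (g : π) :
    elementTrace ρ g⁻¹ = elementTrace ρ g := by
  unfold elementTrace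
  rw [map_inv, Matrix.SpecialLinearGroup.coe_inv, Matrix.adjugate_fin_two]
  simp [Matrix.trace_fin_two, add_comm]

theorem elementTrace_of_isConj (ρ : π →* SL(2, ℂ)) {g h : π} (H : IsConj g h) :
    elementTrace ρ g = elementTrace ρ h := by
  obtain ⟨c, rfl⟩ := isConj_iff.1 H
  unfold elementTrace
  rw [map_mul, map_mul, Matrix.SpecialLinearGroup.coe_mul, Matrix.trace_mul_comm,
    ← Matrix.SpecialLinearGroup.coe_mul, ← mul_assoc, ← map_mul ρ c⁻¹ c]
  simp

/-- The trace `tr ρ(X)` of a curve `X ∈ Ω`. -/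
def curveTrace (ρ : π →* SL(2, ℂ)) : Curves π → ℂ :=
  Quotient.lift (fun g : {g : π // IsPrimitive g} => elementTrace ρ g.1) (by
    rintro g h (H | H)
    · exact elementTrace_of_isConj ρ H
    · exact (elementTrace_of_isConj ρ H).trans (elementTrace_inv ρ h.1))

/-- The peripheral trace `τ = tr ρ(a b a⁻¹ b⁻¹)`, computed in the free basis `a = b 0`, `b = b 1`. -/
def peripheralTrace (ρ : π →* SL(2, ℂ)) (b : FreeGroupBasis (Fin 2) π) : ℂ :=
  elementTrace ρ (b 0 * b 1 * (b 0)⁻¹ * (b 1)⁻¹)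

/-- The linear representation of `π` on `ℂ²` given by `ρ`. -/
def linearRep (ρ : π →* SL(2, ℂ)) : Representation ℂ π (Fin 2 → ℂ) where
  toFun g := Matrix.toLin' (ρ g : Matrix (Fin 2) (Fin 2) ℂ)
  map_one' := by simp; rfl
  map_mul' g h := by
    rw [map_mul, Matrix.SpecialLinearGroup.coe_mul, Matrix.toLin'_mul]; rfl

/-- `ρ` is irreducible: no line of `ℂ²` is invariant under `ρ(π)`. -/
def IsIrred (ρ : π →* SL(2, ℂ)) : Prop := (linearRep ρ).IsIrreducible

/-- The Bowditch conditions. -/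
structure BowditchConditions (ρ : π →* SL(2, ℂ)) : Prop where
  trace_notMem : ∀ X : Curves π, ¬ ∃ t : ℝ, t ∈ Set.Icc (-2 : ℝ) 2 ∧ curveTrace ρ X = (t : ℂ)
  finite_small : {X : Curves π | ‖curveTrace ρ X‖ ≤ 2}.Finite

end PuncturedTorus

end

/-! The curves are the complementary regions of a planar trivalent tree whose edges are the bases of
π up to conjugation, exchange and inversion. Cut at the edge of `(b 0, b 1)`, the tree becomes two
binary trees, and Ω is indexed by the two sides of that edge and by the words over `Bool` in each
half (`treeCurve_bijective`). Surjectivity rests on Nielsen's theorem in rank two,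
`FreeGroup.rel_of_rel_generating_pair`; injectivity on homology, where the regions have distinct
Farey coordinates.

Traces form a Markoff map: for an edge with sides x, y and ends z, back, one has z + back = xy and
x² + y² + z² − xyz = μ. A directed edge carries `gap`, a corrected form of back/(xy), with gap(left)
+ gap(right) = gap − 2h(z) and gap + gap(reverse) = 1 − 2h(x) − 2h(y). If the gaps at depth n have
sums tending to zero, telescoping shows that the edge is filled: its gap is the sum of 2h over the
regions ahead. When both directions of the initial edge are filled, the total of 2h is 1.

Filling needs growth. If |back| ≤ |z| and both sides exceed 2, the values ahead grow exponentially
in the Farey coordinates, so their inverse squares are summable and dominate the gaps. Suppose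
instead that all values are large and an edge is unfilled. It then starts an infinite path of edges
pointing backwards, along which |x| + |y| + |back| drops by a definite amount at each step because μ
≠ 4, a contradiction (`not_isUnfilled`); μ ≠ 4 is a consequence of irreducibility
(`peripheralTrace_ne_two`). Around a region with |x| ≤ 2, growth comes from the recursion y ↦ z ↦ xz
− y, which is hyperbolic since x ∉ [−2, 2]. The finitely many remaining small values are absorbed by
induction on depth. The same recursion gives x² ≠ μ: up to a nonzero factor, x² − μ is the product
of its leading coefficients in the two directions. -/

namespace FreeGroup

/-! ### Cancellation in free groups as a Gromov product -/

variable {α : Type*} [DecidableEq α]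

/-- The length of the longest common prefix of two lists. -/
def prefixLength {β : Type*} [DecidableEq β] : List β → List β → ℕ
  | a :: l, b :: m => if a = b then prefixLength l m + 1 else 0
  | _, _ => 0

theorem prefixLength_comm {β : Type*} [DecidableEq β] :
    ∀ l m : List β, prefixLength l m = prefixLength m l
  | [], [] => rfl
  | [], _ :: _ => rfl
  | _ :: _, [] => rfl
  | a :: l, b :: m => by
    simp only [prefixLength, prefixLength_comm l m, eq_comm]

theorem prefixLength_le {β : Type*} [DecidableEq β] :
    ∀ l m : List β, prefixLength l m ≤ l.length
  | [], _ => by simp [prefixLength]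
  | _ :: _, [] => by simp [prefixLength]
  | a :: l, b :: m => by
    have := prefixLength_le l m
    simp only [prefixLength, List.length_cons]
    split_ifs <;> omega

/-- This is the 0-hyperbolicity of the Cayley tree, from which all comparisons of cancellations
below are drawn. -/
theorem min_prefixLength_le {β : Type*} [DecidableEq β] :
    ∀ l m k : List β, min (prefixLength l m) (prefixLength m k) ≤ prefixLength l k
  | [], _, _ => by simp [prefixLength]
  | _ :: _, [], _ => by simp [prefixLength]
  | _ :: _, _ :: _, [] => by simp [prefixLength]
  | a :: l, b :: m, c :: k => by
    have := min_prefixLength_le l m k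
    simp only [prefixLength]
    split_ifs <;> simp_all

theorem getElem_eq_of_lt_prefixLength {β : Type*} [DecidableEq β] :
    ∀ (l m : List β) (i : ℕ), i < prefixLength l m → l[i]? = m[i]?
  | [], _, _, h => by simp [prefixLength] at h
  | _ :: _, [], _, h => by simp [prefixLength] at h
  | a :: l, b :: m, i, h => by
    simp only [prefixLength] at h
    split_ifs at h with hab
    · cases i with
      | zero => simp [hab]
      | succ i => simpa using getElem_eq_of_lt_prefixLength l m i (by omega)
    · omega

/-- Once the common prefix is cancelled the first letters differ, so the remaining product is
already reduced. -/
theorem length_reduce_invRev_append : ∀ l m : List (α × Bool), IsReduced l → IsReduced m →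
    (reduce (invRev l ++ m)).length + 2 * prefixLength l m = l.length + m.length
  | [], m, _, hm => by simp [prefixLength, hm.reduce_eq]
  | a :: l, [], hl, _ => by
    rw [List.append_nil, reduce_invRev, hl.reduce_eq]
    simp [prefixLength]
  | a :: l, b :: m, hl, hm => by
    by_cases hab : a = b
    · subst hab
      have ih := length_reduce_invRev_append l m (List.IsChain.tail hl) (List.IsChain.tail hm)
      have key : reduce (invRev (a :: l) ++ a :: m) = reduce (invRev l ++ m) := by
        apply reduce.sound
        rw [← mul_mk, ← mul_mk, ← inv_mk, ← inv_mk]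
        have h1 : ∀ t : List (α × Bool), mk (a :: t) = mk [a] * mk t := fun t => by
          rw [mul_mk]; rfl
        rw [h1 l, h1 m]
        group
      rw [key]
      simp only [prefixLength, List.length_cons, if_true]
      omega
    · have hred : IsReduced (invRev (a :: l) ++ b :: m) := by
        have h1 : IsReduced (invRev (a :: l)) := by
          rw [isReduced_iff_reduce_eq, reduce_invRev, hl.reduce_eq]
        refine List.isChain_append.2 ⟨h1, hm, ?_⟩
        intro x hx y hy
        simp only [List.head?_cons, Option.mem_def, Option.some.injEq] at hy
        subst hy
        simp only [invRev, List.map_cons, List.reverse_cons, List.getLast?_append,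
          List.getLast?_singleton, Option.some_or, Option.mem_def, Option.some.injEq] at hx
        subst hx
        intro h
        by_contra hne
        apply hab
        obtain ⟨a1, a2⟩ := a
        obtain ⟨b1, b2⟩ := b
        simp only at h hne
        subst h
        cases a2 <;> cases b2 <;> simp_all
      rw [hred.reduce_eq]
      simp [prefixLength, hab]

/-- The Gromov product at `1` in the Cayley tree: the length of the common initial segment of two
reduced words. -/
def gromov (g h : FreeGroup α) : ℕ := prefixLength g.toWord h.toWord

theorem gromov_comm (g h : FreeGroup α) : gromov g h = gromov h g := prefixLength_comm _ _

theorem gromov_le_left (g h : FreeGroup α) : gromov g h ≤ norm g := prefixLength_le _ _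

theorem min_gromov_le (g h k : FreeGroup α) : min (gromov g h) (gromov h k) ≤ gromov g k :=
  min_prefixLength_le _ _ _

theorem norm_inv_mul (g h : FreeGroup α) :
    norm (g⁻¹ * h) + 2 * gromov g h = norm g + norm h := by
  have := length_reduce_invRev_append g.toWord h.toWord isReduced_toWord isReduced_toWord
  rwa [← toWord_inv, ← toWord_mul] at this

theorem norm_mul (g h : FreeGroup α) :
    norm (g * h) + 2 * gromov g⁻¹ h = norm g + norm h := by
  have := norm_inv_mul g⁻¹ h
  rwa [inv_inv, norm_inv_eq] at this

theorem exists_prefix (g : FreeGroup α) {n : ℕ} (hn : n ≤ norm g) :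
    ∃ p : FreeGroup α, norm p = n ∧ gromov p g = n := by
  have hred : IsReduced (g.toWord.take n) := List.IsChain.take isReduced_toWord n
  have key : ∀ (l : List (α × Bool)) (n : ℕ), n ≤ l.length → prefixLength (l.take n) l = n := by
    intro l
    induction l with
    | nil => intro n hn; simp at hn; simp [hn, prefixLength]
    | cons a l ih =>
      intro n hn
      cases n with
      | zero => simp [prefixLength]
      | succ n => simp [prefixLength, ih n (by simpa using hn)]
  refine ⟨mk (g.toWord.take n), ?_, ?_⟩
  · rw [norm, toWord_mk, hred.reduce_eq, List.length_take]
    exact min_eq_left hn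
  · rw [gromov, toWord_mk, hred.reduce_eq]
    exact key _ _ hn

/-- Otherwise g and its inverse agree up to the middle of the word. Then the middle letter is its
own inverse, or the two middle letters are mutually inverse, against reducedness. -/
theorem two_mul_gromov_inv_self_lt {g : FreeGroup α} (hg : g ≠ 1) :
    2 * gromov g⁻¹ g < norm g := by
  by_contra hle
  push Not at hle
  have hpos : 0 < norm g := Nat.pos_of_ne_zero fun h => hg (norm_eq_zero.1 h)
  have hinv : ∀ i, i < norm g → (g⁻¹).toWord[i]? =
      (g.toWord[norm g - 1 - i]?).map fun x => (x.1, !x.2) := by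
    intro i hi
    rw [toWord_inv, invRev, List.getElem?_reverse (by simpa [norm] using hi)]
    simp [norm]
  have hagree : ∀ i, i < gromov g⁻¹ g → (g⁻¹).toWord[i]? = g.toWord[i]? :=
    fun i hi => getElem_eq_of_lt_prefixLength _ _ i hi
  obtain ⟨k, hk | hk⟩ := Nat.even_or_odd' (norm g)
  · have h1 := hinv (k - 1) (by omega)
    rw [hagree _ (by omega), show norm g - 1 - (k - 1) = k by omega] at h1
    have hk1 : k < g.toWord.length := by have : norm g = g.toWord.length := rfl; omega
    have hk2 : k - 1 < g.toWord.length := by omega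
    rw [List.getElem?_eq_getElem hk1, List.getElem?_eq_getElem hk2] at h1
    simp only [Option.map_some, Option.some.injEq] at h1
    have hred : IsReduced g.toWord := isReduced_toWord
    have h2 := List.isChain_iff_getElem.1 hred (k - 1) (by omega)
    have h3 : k - 1 + 1 = k := by omega
    simp only [h3] at h2
    rw [h1] at h2
    simp at h2
  · have h1 := hinv k (by omega)
    rw [hagree _ (by omega), show norm g - 1 - k = k by omega] at h1
    have hk1 : k < g.toWord.length := by have : norm g = g.toWord.length := rfl; omega
    rw [List.getElem?_eq_getElem hk1] at h1
    simp only [Option.map_some, Option.some.injEq] at h1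
    have := congrArg Prod.snd h1
    simp at this

end FreeGroup

namespace FreeGroup

/-! ### Local cancellation bounds and the length of products -/

section LocalToGlobal

variable {α : Type*} [DecidableEq α] {β : Type*}

/-- The number of cancelling pairs in `f l₁ * f l₂`. -/
def cancellation (f : β → FreeGroup α) (l₁ l₂ : β) : ℕ := gromov (f l₁)⁻¹ (f l₂)

variable {r : β → β → Prop} {f : β → FreeGroup α}
  (h : ∀ l₁ l₂ l₃, r l₁ l₂ → r l₂ l₃ →
    cancellation f l₁ l₂ + cancellation f l₂ l₃ < norm (f l₂))
  (hr : ∀ l, r l l)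

include h in
-- The cancellations at the two ends of each factor do not meet, so part of `f l₂` survives and
-- shields `f l₁` from the later factors.
theorem gromov_inv_prod_eq : ∀ (t : List β) (l₁ l₂ : β), (l₁ :: l₂ :: t).IsChain r →
    gromov (f l₁)⁻¹ ((l₂ :: t).map f).prod = cancellation f l₁ l₂
  | [], l₁, l₂, _ => by simp [cancellation]
  | l₃ :: t, l₁, l₂, hc => by
    obtain ⟨h12, hc'⟩ := List.isChain_cons_cons.1 hc
    have h23 := (List.isChain_cons_cons.1 hc').1
    have ih := gromov_inv_prod_eq t l₂ l₃ hc'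
    have hlt := h l₁ l₂ l₃ h12 h23
    rw [List.map_cons, List.prod_cons]
    set p := ((l₃ :: t).map f).prod
    have e1 := norm_inv_mul (f l₂) (f l₂ * p)
    rw [inv_mul_cancel_left] at e1
    have e2 := norm_mul (f l₂) p
    have e3 := min_gromov_le (f l₁)⁻¹ (f l₂) (f l₂ * p)
    have e4 := min_gromov_le (f l₁)⁻¹ (f l₂ * p) (f l₂)
    rw [gromov_comm (f l₂ * p) (f l₂)] at e4
    simp only [cancellation] at *
    omega

include h hr in
-- The cancellation with a preceding factor is included so that the induction closes: each factor
-- keeps at least one letter beyond what its two neighbours cancel.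
theorem length_add_cancellation_le : ∀ (t : List β) (l₀ l₁ : β), (l₀ :: l₁ :: t).IsChain r →
    (l₁ :: t).length + cancellation f l₀ l₁ ≤ norm ((l₁ :: t).map f).prod
  | [], l₀, l₁, hc => by
    have h01 := (List.isChain_cons_cons.1 hc).1
    have := h l₀ l₁ l₁ h01 (hr l₁)
    simp only [List.length_singleton, List.map_cons, List.map_nil, List.prod_singleton]
    omega
  | l₂ :: t, l₀, l₁, hc => by
    obtain ⟨h01, hc'⟩ := List.isChain_cons_cons.1 hc
    have h12 := (List.isChain_cons_cons.1 hc').1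
    have ih := length_add_cancellation_le t l₁ l₂ hc'
    have hg := gromov_inv_prod_eq h t l₁ l₂ hc'
    have hlt := h l₀ l₁ l₂ h01 h12
    rw [List.map_cons, List.prod_cons]
    have e2 := norm_mul (f l₁) ((l₂ :: t).map f).prod
    simp only [List.length_cons] at ih ⊢
    omega

include h hr in
theorem length_le_norm_prod {t : List β} (hc : t.IsChain r) :
    t.length ≤ norm (t.map f).prod := by
  cases t with
  | nil => simp
  | cons l t =>
    have := length_add_cancellation_le h hr t l l (List.isChain_cons_cons.2 ⟨hr l, hc⟩)
    omega

end LocalToGlobal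

/-! ### Nielsen reduction of generating pairs -/

section Nielsen

local notation "F₂" => FreeGroup (Fin 2)

theorem closure_pair_ne_top (g : F₂) : Subgroup.closure {1, g} ≠ (⊤ : Subgroup F₂) := by
  intro h
  have hc : ∀ x : F₂, ∃ n : ℤ, g ^ n = x := by
    intro x
    have hx : x ∈ Subgroup.closure {1, g} := h ▸ Subgroup.mem_top x
    have hle : Subgroup.closure {1, g} ≤ Subgroup.zpowers g := by
      rw [Subgroup.closure_le]
      rintro y (rfl | rfl)
      · exact one_mem _
      · exact Subgroup.mem_zpowers _
    exact Subgroup.mem_zpowers_iff.1 (hle hx)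
  obtain ⟨m, hm⟩ := hc (of 0)
  obtain ⟨n, hn⟩ := hc (of 1)
  have hcomm : (of 0 * of 1 : F₂) = of 1 * of 0 := by
    rw [← hm, ← hn, ← zpow_add, ← zpow_add, add_comm]
  revert hcomm
  decide

/-- The letters `u, u⁻¹, v, v⁻¹`. -/
def pairLetter (u v : F₂) (l : Fin 2 × Bool) : F₂ :=
  cond l.2 (![u, v] l.1) (![u, v] l.1)⁻¹

variable {R : F₂ → F₂ → Prop} {u v : F₂}

theorem pairLetter_not (l : Fin 2) (b : Bool) :
    pairLetter u v (l, !b) = (pairLetter u v (l, b))⁻¹ := by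
  cases b <;> simp [pairLetter]

theorem rel_pairLetter (hswap : ∀ a b, R a b → R b a) (hinv : ∀ a b, R a b → R a⁻¹ b)
    (h : R u v) {l l' : Fin 2 × Bool} (hl : l.1 ≠ l'.1) :
    R (pairLetter u v l) (pairLetter u v l') := by
  have hinv' : ∀ a b, R a b → R a b⁻¹ := fun a b H => hswap _ _ (hinv _ _ (hswap _ _ H))
  obtain ⟨i, s⟩ := l
  obtain ⟨j, t⟩ := l'
  fin_cases i <;> fin_cases j <;> simp at hl <;> cases s <;> cases t <;>
    simp [pairLetter] <;>
    first
      | exact h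
      | exact hinv _ _ h
      | exact hinv' _ _ h
      | exact hinv _ _ (hinv' _ _ h)
      | exact hswap _ _ h
      | exact hinv _ _ (hswap _ _ h)
      | exact hinv' _ _ (hswap _ _ h)
      | exact hinv _ _ (hinv' _ _ (hswap _ _ h))

/-- Split w = p q⁻¹ into halves. The hypotheses say that x begins with q and ends with p⁻¹; these
pieces do not overlap since 2k ≤ |x|, so both are removed in q⁻¹ x p. -/
theorem norm_mul_prefixes {x w p q : F₂} {k : ℕ} (hw : norm w = 2 * k)
    (hxw : gromov x⁻¹ w = k) (hwx : gromov w⁻¹ x = k) (hx : 2 * k ≤ norm x)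
    (hp : norm p = k) (hpw : gromov p w = k) (hq : q = w⁻¹ * p) :
    norm q = k ∧ norm (q⁻¹ * x * p) + 2 * k ≤ norm x := by
  have hqn : norm q = k := by
    have := norm_inv_mul w p
    rw [← hq, gromov_comm, hpw] at this
    omega
  refine ⟨hqn, ?_⟩
  have hqw : gromov q w⁻¹ = k := by
    have := norm_inv_mul q w⁻¹
    rw [hq, mul_inv_rev, inv_inv, mul_assoc, mul_inv_cancel, mul_one, ← hq, norm_inv_eq,
      norm_inv_eq] at this
    omega
  have hqx : k ≤ gromov q x := by
    have := min_gromov_le q w⁻¹ x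
    omega
  have hxp : k ≤ gromov x⁻¹ p := by
    have := min_gromov_le x⁻¹ w p
    rw [gromov_comm w p] at this
    omega
  have h1 := norm_inv_mul q x
  have h2 := gromov_le_left q x
  have h3 := norm_inv_mul (x⁻¹ * q) x⁻¹
  have e1 : (x⁻¹ * q)⁻¹ * x⁻¹ = q⁻¹ := by group
  have e2 : norm (x⁻¹ * q) = norm (q⁻¹ * x) := by
    rw [← norm_inv_eq (x := q⁻¹ * x)]; congr 1; group
  rw [e1, e2, norm_inv_eq, norm_inv_eq] at h3
  have h4 := min_gromov_le (x⁻¹ * q) x⁻¹ p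
  have h5 := norm_mul (q⁻¹ * x) p
  have e3 : (q⁻¹ * x)⁻¹ = x⁻¹ * q := by group
  rw [e3] at h5
  omega

/-- **Nielsen's theorem in rank two**: by elementary moves and simultaneous conjugation, every
generating pair of the free group of rank two can be transformed into the standard one. -/
theorem rel_of_rel_generating_pair (hswap : ∀ a b, R a b → R b a) (hinv : ∀ a b, R a b → R a⁻¹ b)
    (hmul : ∀ a b, R a b → R a (a * b)) (hconj : ∀ a b g, R a b → R (g * a * g⁻¹) (g * b * g⁻¹))
    (hgen : ∀ a b, R a b → Subgroup.closure {a, b} = (⊤ : Subgroup F₂))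
    {a b : F₂} (hab : R a b) : R (of 0) (of 1) := by
  obtain ⟨⟨u, v⟩, huv, hmin⟩ :
      ∃ p : F₂ × F₂, R p.1 p.2 ∧ ∀ x y, R x y → norm p.1 + norm p.2 ≤ norm x + norm y := by
    obtain ⟨p, hp, hp'⟩ := WellFounded.has_min
      (measure fun p : F₂ × F₂ => norm p.1 + norm p.2).wf {p | R p.1 p.2} ⟨(a, b), hab⟩
    exact ⟨p, hp, fun x y hxy => not_lt.1 (hp' (x, y) hxy)⟩
  simp only at huv hmin
  set f := pairLetter u v with hf
  have hinv' : ∀ a b, R a b → R a b⁻¹ := fun a b H => hswap _ _ (hinv _ _ (hswap _ _ H))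
  have hmul' : ∀ x y, R x y → R (x * y) y := by
    intro x y H
    have := hmul _ _ (hinv _ _ (hinv' _ _ (hswap _ _ H)))
    simpa using hswap _ _ (hinv _ _ (hinv' _ _ this))
  have hR : ∀ l l' : Fin 2 × Bool, l.1 ≠ l'.1 → R (f l) (f l') := fun l l' hl =>
    rel_pairLetter hswap hinv huv hl
  have hsum : ∀ l l' : Fin 2 × Bool, l.1 ≠ l'.1 →
      norm (f l) + norm (f l') = norm u + norm v := by
    rintro ⟨i, s⟩ ⟨j, t⟩ hl
    fin_cases i <;> fin_cases j <;> simp at hl <;> cases s <;> cases t <;>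
      simp [hf, pairLetter, norm_inv_eq, add_comm]
  have hne : ∀ l : Fin 2 × Bool, f l ≠ 1 := by
    intro l hl
    have h1 : l.1 ≠ (l.1 + 1, true).1 := by
      obtain ⟨i, s⟩ := l
      fin_cases i <;> simp
    have h2 := hgen _ _ (hR l (l.1 + 1, true) h1)
    rw [hl] at h2
    exact closure_pair_ne_top _ h2
  have hfinv : ∀ l l' : Fin 2 × Bool, l.1 = l'.1 → l.2 ≠ l'.2 → f l' = (f l)⁻¹ := by
    rintro ⟨i, s⟩ ⟨j, t⟩ h1 h2
    simp only at h1 h2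
    subst h1
    rw [hf, ← pairLetter_not]
    cases s <;> cases t <;> simp_all
  -- Replacing one entry by the product cannot shorten a minimal pair, so at most half of either
  -- factor cancels.
  have hdiff : ∀ l l' : Fin 2 × Bool, l.1 ≠ l'.1 → 2 * cancellation f l l' ≤ norm (f l) ∧
      2 * cancellation f l l' ≤ norm (f l') := by
    intro l l' hl
    have h1 := hmin _ _ (hmul _ _ (hR l l' hl))
    have h2 := hmin _ _ (hmul' _ _ (hR l l' hl))
    have h3 := hsum l l' hl
    have h4 := norm_mul (f l) (f l')
    simp only [cancellation]
    omega
  have hsame : ∀ l : Fin 2 × Bool, 2 * cancellation f l l < norm (f l) := fun l =>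
    two_mul_gromov_inv_self_lt (hne l)
  -- If x cancels exactly half of w = p q⁻¹ from either side, multiplication alone leaves the total
  -- length unchanged. Conjugating (xw, w) by q⁻¹ gives (q⁻¹xp, q⁻¹p), which is strictly shorter.
  have hhalf : ∀ l l' : Fin 2 × Bool, l.1 ≠ l'.1 → 2 * cancellation f l l' = norm (f l') →
      2 * cancellation f l' l ≠ norm (f l') := by
    intro l l' hl h1 h2
    have h3 := (hdiff l l' hl).1
    simp only [cancellation] at h1 h2 h3
    set k := gromov (f l)⁻¹ (f l') with hk
    obtain ⟨p, hp, hpw⟩ := exists_prefix (f l') (n := k) (by omega)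
    obtain ⟨hq, hlt⟩ := norm_mul_prefixes (x := f l) (w := f l') (p := p) (q := (f l')⁻¹ * p)
      (k := k) (by omega) hk.symm (by omega) (by omega) hp hpw rfl
    set q := (f l')⁻¹ * p with hqdef
    have h4 : R (q⁻¹ * f l * p) (q⁻¹ * p) := by
      have h5 := hconj _ _ q⁻¹ (hmul' _ _ (hR l l' hl))
      have e1 : q⁻¹ * (f l * f l') * q⁻¹⁻¹ = q⁻¹ * f l * p := by rw [hqdef]; group
      have e2 : q⁻¹ * f l' * q⁻¹⁻¹ = q⁻¹ * p := by rw [hqdef]; group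
      rwa [e1, e2] at h5
    have h5 := hmin _ _ h4
    have h6 := hsum l l' hl
    have h7 := norm_mul_le q⁻¹ p
    rw [norm_inv_eq] at h7
    have h8 : 0 < norm (f l') := Nat.pos_of_ne_zero fun h => hne l' (norm_eq_zero.1 h)
    omega
  have hlocal : ∀ l₁ l₂ l₃ : Fin 2 × Bool, (l₁.1 = l₂.1 → l₁.2 = l₂.2) →
      (l₂.1 = l₃.1 → l₂.2 = l₃.2) →
      cancellation f l₁ l₂ + cancellation f l₂ l₃ < norm (f l₂) := by
    intro l₁ l₂ l₃ h12 h23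
    have hs := hsame l₂
    by_cases e12 : l₁.1 = l₂.1
    · obtain rfl : l₁ = l₂ := Prod.ext e12 (h12 e12)
      by_cases e23 : l₁.1 = l₃.1
      · obtain rfl : l₁ = l₃ := Prod.ext e23 (h23 e23)
        omega
      · have := (hdiff _ _ e23).1
        omega
    · have d12 := (hdiff _ _ e12).2
      by_cases e23 : l₂.1 = l₃.1
      · obtain rfl : l₂ = l₃ := Prod.ext e23 (h23 e23)
        omega
      · have d23 := (hdiff _ _ e23).1
        have e13 : l₁.1 = l₃.1 := by omega
        by_cases s13 : l₁.2 = l₃.2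
        · obtain rfl : l₁ = l₃ := Prod.ext e13 s13
          have := hhalf l₁ l₂ e12
          omega
        -- The outer letters are mutually inverse. If both cancelled half of `f l₂`, this word and
        -- its inverse would agree on half their length, against `hsame`.
        · have e := hfinv l₁ l₃ e13 s13
          have h1 := min_gromov_le (f l₂)⁻¹ (f l₁)⁻¹ (f l₂)
          have h2 : cancellation f l₂ l₃ = gromov (f l₂)⁻¹ (f l₁)⁻¹ := by
            simp only [cancellation, e]
          simp only [cancellation] at *
          omega
  -- A generator has length one, so the length bound leaves only one-letter words in u and v.
  have hletter : ∀ i : Fin 2, ∃ l, f l = of i := by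
    intro i
    have h1 : (of i : F₂) ∈ (lift ![u, v]).range := by
      have h2 : Subgroup.closure {u, v} ≤ (lift ![u, v]).range := by
        rw [Subgroup.closure_le]
        rintro y (rfl | rfl)
        · exact ⟨of 0, by simp⟩
        · exact ⟨of 1, by simp⟩
      rw [hgen _ _ huv] at h2
      exact h2 (Subgroup.mem_top _)
    obtain ⟨w, hw⟩ := h1
    have h2 : (w.toWord.map f).prod = of i := by
      rw [← hw]
      conv_rhs => rw [← mk_toWord (x := w)]
      rw [lift_mk]
      rfl
    have h3 := length_le_norm_prod hlocal (fun _ _ => rfl) (t := w.toWord) isReduced_toWord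
    rw [h2, norm_of] at h3
    match w.toWord, h2, h3 with
    | [], h2, _ => simp at h2
    | [l], h2, _ => exact ⟨l, by simpa using h2⟩
    | _ :: _ :: _, _, h3 => simp at h3
  obtain ⟨l, hl⟩ := hletter 0
  obtain ⟨l', hl'⟩ := hletter 1
  rw [← hl, ← hl']
  apply hR
  intro h
  by_cases hs : l.2 = l'.2
  · rw [Prod.ext h hs, hl'] at hl
    revert hl; decide
  · have := hfinv l l' h hs
    rw [hl, hl'] at this
    revert this; decide

end Nielsen

end FreeGroup

/-! ### The binary tree of bases and its Farey coordinates -/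

namespace PuncturedTorus

variable {π : Type*} [Group π]

/-- The pairs of elements attached to the edges of the binary tree below the pair `(u, v)`. -/
def pairDescend : π → π → List Bool → π × π
  | u, v, [] => (u, v)
  | u, v, true :: w => pairDescend u (u * v) w
  | u, v, false :: w => pairDescend (u * v) v w

theorem pairDescend_append (u v : π) (w w' : List Bool) :
    pairDescend u v (w ++ w') =
      pairDescend (pairDescend u v w).1 (pairDescend u v w).2 w' := by
  induction w generalizing u v with
  | nil => rfl
  | cons s w ih => cases s <;> simp [pairDescend, ih]

/-- The element that appears at the far end of an edge of the binary tree below `(u, v)`. -/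
def pairHead (u v : π) (w : List Bool) : π := (pairDescend u v w).1 * (pairDescend u v w).2

theorem pairHead_true (u v : π) (w : List Bool) :
    pairHead u v (true :: w) = pairHead u (u * v) w := rfl

theorem pairHead_false (u v : π) (w : List Bool) :
    pairHead u v (false :: w) = pairHead (u * v) v w := rfl

/-- The Farey coordinates of the vertices of the binary tree. -/
def farey : List Bool → ℕ × ℕ
  | [] => (1, 1)
  | true :: w => ((farey w).1 + (farey w).2, (farey w).2)
  | false :: w => ((farey w).1, (farey w).1 + (farey w).2)

theorem farey_pos (w : List Bool) : 0 < (farey w).1 ∧ 0 < (farey w).2 := by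
  induction w with
  | nil => simp [farey]
  | cons s w ih => cases s <;> simp only [farey] <;> omega

/-- This is Euclid's algorithm: comparing the two coordinates recovers the first letter, and a
subtraction removes it. -/
theorem farey_injective : Function.Injective farey := by
  intro w
  induction w with
  | nil =>
    rintro (_ | ⟨s, w'⟩) h
    · rfl
    · have := farey_pos w'
      cases s <;> simp [farey, Prod.ext_iff] at h <;> omega
  | cons s w ih =>
    rintro (_ | ⟨s', w'⟩) h
    · have := farey_pos w
      cases s <;> simp [farey, Prod.ext_iff] at h <;> omega
    · have h1 := farey_pos w
      have h2 := farey_pos w'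
      cases s <;> cases s' <;> simp only [farey, Prod.ext_iff] at h
      · rw [ih (Prod.ext h.1 (by omega))]
      · omega
      · omega
      · rw [ih (Prod.ext (by omega) h.2)]

theorem map_pairHead {A : Type*} [AddCommGroup A] (f : π →* Multiplicative A) (u v : π)
    (w : List Bool) : (f (pairHead u v w)).toAdd =
      (farey w).1 • (f u).toAdd + (farey w).2 • (f v).toAdd := by
  induction w generalizing u v with
  | nil => simp [pairHead, pairDescend, farey]
  | cons s w ih =>
    cases s
    · rw [pairHead_false, ih]
      simp only [farey, map_mul, toAdd_mul, add_smul, smul_add]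
      abel
    · rw [pairHead_true, ih]
      simp only [farey, map_mul, toAdd_mul, add_smul, smul_add]
      abel

/-! ### Elementary moves on bases -/

/-- The two elements form a free basis. -/
def IsBasisPair (u v : π) : Prop := ∃ c : FreeGroupBasis (Fin 2) π, c 0 = u ∧ c 1 = v

theorem IsBasisPair.of_inverse {u v : π} (h : IsBasisPair u v)
    {f g : Fin 2 → FreeGroup (Fin 2)} (hfg : ∀ i, FreeGroup.lift f (g i) = FreeGroup.of i)
    (hgf : ∀ i, FreeGroup.lift g (f i) = FreeGroup.of i) :
    IsBasisPair (FreeGroup.lift ![u, v] (f 0)) (FreeGroup.lift ![u, v] (f 1)) := by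
  obtain ⟨c, rfl, rfl⟩ := h
  have hc : (c.repr.symm : FreeGroup (Fin 2) →* π) = FreeGroup.lift ![c 0, c 1] := by
    ext i
    fin_cases i <;> simp <;> rfl
  let φ : FreeGroup (Fin 2) ≃* FreeGroup (Fin 2) :=
    MonoidHom.toMulEquiv (FreeGroup.lift f) (FreeGroup.lift g)
      (FreeGroup.ext_hom _ _ fun i => by simpa using hgf i)
      (FreeGroup.ext_hom _ _ fun i => by simpa using hfg i)
  have hφ : ∀ i, φ (FreeGroup.of i) = f i := fun i => FreeGroup.lift_apply_of
  refine ⟨FreeGroupBasis.ofRepr (c.repr.trans φ.symm), ?_, ?_⟩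
  · rw [← hc]
    change c.repr.symm (φ (FreeGroup.of 0)) = _
    rw [hφ]
    rfl
  · rw [← hc]
    change c.repr.symm (φ (FreeGroup.of 1)) = _
    rw [hφ]
    rfl

theorem IsBasisPair.mul_right {u v : π} (h : IsBasisPair u v) : IsBasisPair u (u * v) := by
  have := h.of_inverse (f := ![FreeGroup.of 0, FreeGroup.of 0 * FreeGroup.of 1])
    (g := ![FreeGroup.of 0, (FreeGroup.of 0)⁻¹ * FreeGroup.of 1])
    (fun i => by fin_cases i <;> simp) (fun i => by fin_cases i <;> simp)
  simpa using this

theorem IsBasisPair.mul_left {u v : π} (h : IsBasisPair u v) : IsBasisPair (u * v) v := by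
  have := h.of_inverse (f := ![FreeGroup.of 0 * FreeGroup.of 1, FreeGroup.of 1])
    (g := ![FreeGroup.of 0 * (FreeGroup.of 1)⁻¹, FreeGroup.of 1])
    (fun i => by fin_cases i <;> simp) (fun i => by fin_cases i <;> simp)
  simpa using this

theorem IsBasisPair.inv_right {u v : π} (h : IsBasisPair u v) : IsBasisPair u v⁻¹ := by
  have := h.of_inverse (f := ![FreeGroup.of 0, (FreeGroup.of 1)⁻¹])
    (g := ![FreeGroup.of 0, (FreeGroup.of 1)⁻¹])
    (fun i => by fin_cases i <;> simp) (fun i => by fin_cases i <;> simp)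
  simpa using this

theorem IsBasisPair.isPrimitive {u v : π} (h : IsBasisPair u v) :
    IsPrimitive u ∧ IsPrimitive v := by
  obtain ⟨c, rfl, rfl⟩ := h
  exact ⟨⟨c, 0, rfl⟩, ⟨c, 1, rfl⟩⟩

theorem IsBasisPair.isPrimitive_pairHead {u v : π} (h : IsBasisPair u v) (w : List Bool) :
    IsPrimitive (pairHead u v w) := by
  induction w generalizing u v with
  | nil => exact h.mul_right.isPrimitive.2
  | cons s w ih =>
    cases s
    · exact ih h.mul_left
    · exact ih h.mul_right

/-! ### Pairs of neighbouring curves -/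

variable (b : FreeGroupBasis (Fin 2) π)

theorem isBasisPair_self : IsBasisPair (b 0) (b 1) := ⟨b, rfl, rfl⟩

/-- The equivalence class of the edges of the tree based at `(b 0, b 1)` with respect to
simultaneous conjugation, exchange, and inversion of one element. -/
inductive TreePair : π → π → Prop
  | pos (w : List Bool) :
      TreePair (pairDescend (b 0) (b 1) w).1 (pairDescend (b 0) (b 1) w).2
  | neg (w : List Bool) :
      TreePair (pairDescend (b 0) (b 1)⁻¹ w).1 (pairDescend (b 0) (b 1)⁻¹ w).2
  | swap {u v : π} : TreePair u v → TreePair v u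
  | inv {u v : π} : TreePair u v → TreePair u⁻¹ v
  | conj {u v : π} (g : π) : TreePair u v → TreePair (g * u * g⁻¹) (g * v * g⁻¹)

namespace TreePair

variable {b} {u v : π}

theorem inv_right (h : TreePair b u v) : TreePair b u v⁻¹ := h.swap.inv.swap

theorem of_conj (g : π) {u' v' : π} (h : TreePair b u v) (hu : g * u * g⁻¹ = u')
    (hv : g * v * g⁻¹ = v') : TreePair b u' v' := hu ▸ hv ▸ h.conj g

/-- The four edges of the tree adjacent to the edge given by `u` and `v`. -/
def Neighbours (b : FreeGroupBasis (Fin 2) π) (u v : π) : Prop :=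
  TreePair b u (u * v) ∧ TreePair b u (u⁻¹ * v) ∧ TreePair b v (u * v) ∧ TreePair b v (u⁻¹ * v)

/-- Two of the adjacent edges are the children. The other two are the parent and the sibling, up to
conjugation and inversion; at the root they are the first edges of the opposite half, hence the
hypothesis on `s⁻¹`. -/
theorem neighbours_descend {s : π} (h : ∀ w, TreePair b (pairDescend (b 0) s w).1
      (pairDescend (b 0) s w).2)
    (h' : ∀ w, TreePair b (pairDescend (b 0) s⁻¹ w).1 (pairDescend (b 0) s⁻¹ w).2)
    (w : List Bool) :
    Neighbours b (pairDescend (b 0) s w).1 (pairDescend (b 0) s w).2 := by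
  have hl := h (w ++ [true])
  have hr := h (w ++ [false])
  rw [pairDescend_append] at hl hr
  refine ⟨hl, ?_, hr.swap, ?_⟩
  · induction w using List.reverseRecOn with
    | nil =>
      exact (h' [true]).inv_right.of_conj (b 0)⁻¹ (by simp [pairDescend])
        (by simp [pairDescend, mul_assoc])
    | append_singleton w t _ =>
      have h0 := h w
      have h1 := h (w ++ [true])
      rw [pairDescend_append] at h1 ⊢
      cases t
      · simp only [pairDescend] at h1 ⊢
        exact h1.inv.swap.of_conj
          ((pairDescend (b 0) s w).1 * (pairDescend (b 0) s w).2)⁻¹ (by group) (by group)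
      · simpa [pairDescend] using h0
  · induction w using List.reverseRecOn with
    | nil =>
      exact (h' [false]).swap.inv.inv_right.of_conj s⁻¹ (by simp [pairDescend])
        (by simp [pairDescend])
    | append_singleton w t _ =>
      have h0 := h w
      have h1 := h (w ++ [false])
      rw [pairDescend_append] at h1 ⊢
      cases t
      · simp only [pairDescend] at h1 ⊢
        exact h0.inv.swap.of_conj (pairDescend (b 0) s w).2⁻¹ (by group) (by group)
      · simpa [pairDescend] using h1

theorem neighbours (h : TreePair b u v) : Neighbours b u v := by
  induction h with
  | pos w => exact neighbours_descend pos neg w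
  | neg w => exact neighbours_descend neg (by simpa using pos) w
  | @swap u v _ ih =>
    obtain ⟨h1, h2, h3, h4⟩ := ih
    exact ⟨h3.of_conj v (by group) (by group), h4.inv_right.of_conj 1 (by group) (by group),
      h1.of_conj u⁻¹ (by group) (by group), h2.inv_right.of_conj 1 (by group) (by group)⟩
  | @inv u v _ ih =>
    obtain ⟨h1, h2, h3, h4⟩ := ih
    exact ⟨h2.inv, by simpa using h1.inv, h4, by simpa using h3⟩
  | @conj u v g _ ih =>
    obtain ⟨h1, h2, h3, h4⟩ := ih
    exact ⟨h1.of_conj g rfl (by group), h2.of_conj g rfl (by group), h3.of_conj g rfl (by group),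
      h4.of_conj g rfl (by group)⟩

end TreePair

theorem closure_basis (c : FreeGroupBasis (Fin 2) π) : Subgroup.closure {c 0, c 1} = ⊤ := by
  have h1 : (Set.range (c : Fin 2 → π)) = {c 0, c 1} := by
    ext x
    simp only [Set.mem_range, Fin.exists_fin_two, Set.mem_insert_iff, Set.mem_singleton_iff,
      eq_comm]
  rw [← h1]
  have h2 : (Set.range (c : Fin 2 → π)) =
      (c.repr.symm : FreeGroup (Fin 2) →* π) '' Set.range FreeGroup.of := by
    rw [← Set.range_comp]; rfl
  rw [h2, ← MonoidHom.map_closure, FreeGroup.closure_range_of, ← MonoidHom.range_eq_map,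
    MonoidHom.range_eq_top]
  exact c.repr.symm.surjective

theorem treePair_basis (c : FreeGroupBasis (Fin 2) π) : TreePair b (c 0) (c 1) := by
  let e := b.repr
  -- `TreePair` stands to the left of the implication, so closure of `R` under a move asks that
  -- `TreePair` survive the inverse move. `R` holds trivially at `c`, and Nielsen's theorem carries
  -- it to `b`.
  let R : FreeGroup (Fin 2) → FreeGroup (Fin 2) → Prop := fun x y =>
    Subgroup.closure {x, y} = ⊤ ∧
      (TreePair b (e.symm x) (e.symm y) → TreePair b (c 0) (c 1))
  have hgen : ∀ {x y x' y' : FreeGroup (Fin 2)}, Subgroup.closure {x, y} = ⊤ →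
      x ∈ Subgroup.closure {x', y'} → y ∈ Subgroup.closure {x', y'} →
      Subgroup.closure {x', y'} = ⊤ := by
    intro x y x' y' h hx hy
    rw [eq_top_iff, ← h, Subgroup.closure_le]
    rintro z (rfl | rfl)
    · exact hx
    · exact hy
  have hl : ∀ x y : FreeGroup (Fin 2), x ∈ Subgroup.closure {x, y} := fun x y =>
    Subgroup.subset_closure (Set.mem_insert _ _)
  have hr : ∀ x y : FreeGroup (Fin 2), y ∈ Subgroup.closure {x, y} := fun x y =>
    Subgroup.subset_closure (Set.mem_insert_of_mem _ rfl)
  have key : R (FreeGroup.of 0) (FreeGroup.of 1) := by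
    refine FreeGroup.rel_of_rel_generating_pair (R := R) (a := e (c 0)) (b := e (c 1))
      ?_ ?_ ?_ ?_ (fun _ _ h => h.1) ?_
    · rintro x y ⟨h1, h2⟩
      exact ⟨Set.pair_comm x y ▸ h1, fun h => h2 h.swap⟩
    · rintro x y ⟨h1, h2⟩
      refine ⟨hgen h1 ?_ (hr _ _), fun h => h2 (by simpa using h.inv)⟩
      simpa using inv_mem (hl x⁻¹ y)
    · rintro x y ⟨h1, h2⟩
      refine ⟨hgen h1 (hl _ _) ?_, fun h => h2 ?_⟩
      · simpa using mul_mem (inv_mem (hl x (x * y))) (hr x (x * y))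
      · simpa using h.neighbours.2.1
    · rintro x y g ⟨h1, h2⟩
      refine ⟨?_, fun h => h2 (h.of_conj (e.symm g)⁻¹ ?_ ?_)⟩
      · have h3 : ({g * x * g⁻¹, g * y * g⁻¹} : Set (FreeGroup (Fin 2))) =
            (MulAut.conj g).toMonoidHom '' {x, y} := by
          rw [Set.image_pair]; rfl
        rw [h3, ← MonoidHom.map_closure, h1, ← MonoidHom.range_eq_map, MonoidHom.range_eq_top]
        exact (MulAut.conj g).surjective
      · simp only [map_mul, map_inv]; group
      · simp only [map_mul, map_inv]; group
    · refine ⟨?_, by simp⟩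
      have h3 : ({e (c 0), e (c 1)} : Set (FreeGroup (Fin 2))) =
          e.toMonoidHom '' {c 0, c 1} := by
        rw [Set.image_pair]; rfl
      rw [h3, ← MonoidHom.map_closure, closure_basis, ← MonoidHom.range_eq_map,
        MonoidHom.range_eq_top]
      exact e.surjective
  exact key.2 (TreePair.pos [])

/-! ### The curves as vertices of the tree -/

/-- The representatives of the curves that are given by the binary tree. -/
def treeElement : Bool ⊕ (List Bool ⊕ List Bool) → π
  | .inl true => b 0
  | .inl false => b 1
  | .inr (.inl w) => pairHead (b 0) (b 1) w
  | .inr (.inr w) => pairHead (b 0) (b 1)⁻¹ w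

theorem isPrimitive_treeElement (i : Bool ⊕ (List Bool ⊕ List Bool)) :
    IsPrimitive (treeElement b i) := by
  rcases i with (_ | _) | w | w
  · exact (isBasisPair_self b).isPrimitive.2
  · exact (isBasisPair_self b).isPrimitive.1
  · exact (isBasisPair_self b).isPrimitive_pairHead w
  · exact (isBasisPair_self b).inv_right.isPrimitive_pairHead w

/-- The curves that are given by the binary tree. -/
def treeCurve (i : Bool ⊕ (List Bool ⊕ List Bool)) : Curves π :=
  Quotient.mk (curveSetoid π) ⟨treeElement b i, isPrimitive_treeElement b i⟩

/-- The element is, up to conjugation and inversion, given by the binary tree. -/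
def IsTreeElement (g : π) : Prop :=
  ∃ i, IsConj (treeElement b i) g ∨ IsConj (treeElement b i) g⁻¹

theorem isTreeElement_descend {s : π}
    (hs : IsTreeElement b s) (h : ∀ w, IsTreeElement b (pairHead (b 0) s w)) (w : List Bool) :
    IsTreeElement b (pairDescend (b 0) s w).1 ∧ IsTreeElement b (pairDescend (b 0) s w).2 := by
  induction w using List.reverseRecOn with
  | nil => exact ⟨⟨.inl true, Or.inl (IsConj.refl _)⟩, hs⟩
  | append_singleton w t ih =>
    have h0 := h w
    rw [pairDescend_append]
    cases t
    · exact ⟨h0, ih.2⟩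
    · exact ⟨ih.1, h0⟩

theorem IsTreeElement.inv {g : π} (h : IsTreeElement b g) : IsTreeElement b g⁻¹ := by
  obtain ⟨i, h | h⟩ := h
  · exact ⟨i, Or.inr (by rwa [inv_inv])⟩
  · exact ⟨i, Or.inl h⟩

theorem IsTreeElement.conj {g : π} (h : IsTreeElement b g) (k : π) :
    IsTreeElement b (k * g * k⁻¹) := by
  obtain ⟨i, h | h⟩ := h
  · exact ⟨i, Or.inl (h.trans (isConj_iff.2 ⟨k, rfl⟩))⟩
  · exact ⟨i, Or.inr (h.trans (isConj_iff.2 ⟨k, by group⟩))⟩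

theorem TreePair.isTreeElement {u v : π} (h : TreePair b u v) :
    IsTreeElement b u ∧ IsTreeElement b v := by
  have h1 : IsTreeElement b (b 1) := ⟨.inl false, Or.inl (IsConj.refl _)⟩
  induction h with
  | pos w =>
    exact isTreeElement_descend b h1
      (fun w => ⟨.inr (.inl w), Or.inl (IsConj.refl _)⟩) w
  | neg w =>
    exact isTreeElement_descend b (h1.inv b)
      (fun w => ⟨.inr (.inr w), Or.inl (IsConj.refl _)⟩) w
  | swap _ ih => exact ih.symm
  | inv _ ih => exact ⟨ih.1.inv b, ih.2⟩
  | conj g _ ih => exact ⟨ih.1.conj b g, ih.2.conj b g⟩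

theorem treeCurve_surjective : Function.Surjective (treeCurve b) := by
  intro X
  induction X using Quotient.inductionOn with
  | h g =>
    obtain ⟨g, c, i, rfl⟩ := g
    have h := (treePair_basis b c).isTreeElement
    have h' : IsTreeElement b (c i) := by
      fin_cases i
      · exact h.1
      · exact h.2
    obtain ⟨j, hj⟩ := h'
    exact ⟨j, Quotient.sound hj⟩

/-- The homology class of an element. -/
def homology : π →* Multiplicative (ℤ × ℤ) :=
  b.lift ![Multiplicative.ofAdd (1, 0), Multiplicative.ofAdd (0, 1)]

theorem homology_zero : (homology b (b 0)).toAdd = (1, 0) := by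
  simp [homology]

theorem homology_one : (homology b (b 1)).toAdd = (0, 1) := by
  simp [homology]

/-- Conjugation preserves homology and inversion negates it. The representatives have classes (1,
0), (0, 1), (p, q) and (p, −q), where p, q > 0 are Farey coordinates, and these are distinct up to
sign. -/
theorem treeCurve_injective : Function.Injective (treeCurve b) := by
  intro i j hij
  have h1 : ∀ {g h : π}, IsConj g h → (homology b g).toAdd = (homology b h).toAdd := by
    intro g h H
    rw [isConj_iff_eq.1 ((homology b).map_isConj H)]
  have h2 : (homology b (treeElement b i)).toAdd = (homology b (treeElement b j)).toAdd ∨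
      (homology b (treeElement b i)).toAdd = -(homology b (treeElement b j)).toAdd := by
    have h3 : IsConj (treeElement b i) (treeElement b j) ∨
      IsConj (treeElement b i) (treeElement b j)⁻¹ := Quotient.exact hij
    rcases h3 with h3 | h3
    · exact Or.inl (h1 h3)
    · exact Or.inr (by rw [h1 h3, map_inv, toAdd_inv])
  rcases i with (_ | _) | w | w <;> rcases j with (_ | _) | w' | w' <;>
    simp only [treeElement, map_pairHead, map_inv, toAdd_inv, homology_zero, homology_one,
      Prod.smul_mk, Prod.neg_mk, Prod.mk_add_mk, Prod.mk.injEq, nsmul_eq_mul] at h2 <;>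
    (try have p1 := farey_pos w) <;> (try have p2 := farey_pos w') <;>
    first
      | rfl
      | (exfalso; omega)
      | (rw [farey_injective (a₁ := w) (a₂ := w') (Prod.ext (by omega) (by omega))])

theorem treeCurve_bijective : Function.Bijective (treeCurve b) :=
  ⟨treeCurve_injective b, treeCurve_surjective b⟩

end PuncturedTorus

/-! ### Directed edges of a Markoff map -/

namespace PuncturedTorus

/-- A directed edge of the tree, with the values of the regions on its two sides and of the region
ahead of it. -/
structure Edge where
  /-- The value of the region on the left. -/
  x : ℂ
  /-- The value of the region on the right. -/
  y : ℂ
  /-- The value of the region ahead. -/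
  z : ℂ

namespace Edge

/-- The value of the region behind the edge. -/
def back (e : Edge) : ℂ := e.x * e.y - e.z

/-- The next edge on the left. -/
def left (e : Edge) : Edge := ⟨e.x, e.z, e.x * e.z - e.y⟩

/-- The next edge on the right. -/
def right (e : Edge) : Edge := ⟨e.z, e.y, e.z * e.y - e.x⟩

/-- The edge with the opposite direction. -/
def reverse (e : Edge) : Edge := ⟨e.x, e.y, e.back⟩

/-- The mirror image of an edge. -/
def swap (e : Edge) : Edge := ⟨e.y, e.x, e.z⟩

/-- The edge at the end of a path of left turns (`true`) and right turns (`false`). -/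
def descend : Edge → List Bool → Edge
  | e, [] => e
  | e, true :: w => descend e.left w
  | e, false :: w => descend e.right w

/-- The `μ`-Markoff equation. -/
def IsMarkoff (μ : ℂ) (e : Edge) : Prop := e.x ^ 2 + e.y ^ 2 + e.z ^ 2 - e.x * e.y * e.z = μ

variable {μ : ℂ} {e : Edge}

@[simp] theorem descend_nil (e : Edge) : e.descend [] = e := rfl

@[simp] theorem descend_true (e : Edge) (w : List Bool) :
    e.descend (true :: w) = e.left.descend w := rfl

@[simp] theorem descend_false (e : Edge) (w : List Bool) :
    e.descend (false :: w) = e.right.descend w := rfl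

theorem descend_append (e : Edge) (w w' : List Bool) :
    e.descend (w ++ w') = (e.descend w).descend w' := by
  induction w generalizing e with
  | nil => rfl
  | cons s w ih => cases s <;> simp [ih]

@[simp] theorem back_left (e : Edge) : e.left.back = e.y := by simp [back, left]

@[simp] theorem back_right (e : Edge) : e.right.back = e.x := by simp [back, right]

@[simp] theorem back_swap (e : Edge) : e.swap.back = e.back := by simp [back, swap, mul_comm]

theorem left_swap (e : Edge) : e.swap.left = e.right.swap := by
  simp [swap, left, right, mul_comm]

theorem right_swap (e : Edge) : e.swap.right = e.left.swap := by
  simp [swap, left, right, mul_comm]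

theorem descend_swap (e : Edge) (w : List Bool) :
    e.swap.descend w = (e.descend (w.map not)).swap := by
  induction w generalizing e with
  | nil => rfl
  | cons s w ih => cases s <;> simp [ih, left_swap, right_swap]

theorem IsMarkoff.left (h : e.IsMarkoff μ) : e.left.IsMarkoff μ := by
  unfold IsMarkoff Edge.left at *
  linear_combination h

theorem IsMarkoff.right (h : e.IsMarkoff μ) : e.right.IsMarkoff μ := by
  unfold IsMarkoff Edge.right at *
  linear_combination h

theorem IsMarkoff.reverse (h : e.IsMarkoff μ) : e.reverse.IsMarkoff μ := by
  unfold IsMarkoff Edge.reverse Edge.back at *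
  linear_combination h

theorem IsMarkoff.swap (h : e.IsMarkoff μ) : e.swap.IsMarkoff μ := by
  unfold IsMarkoff Edge.swap at *
  linear_combination h

theorem IsMarkoff.descend (h : e.IsMarkoff μ) (w : List Bool) : (e.descend w).IsMarkoff μ := by
  induction w generalizing e with
  | nil => exact h
  | cons s w ih =>
    cases s
    · exact ih h.right
    · exact ih h.left

end Edge

/-! ### Trace identities in SL(2, ℂ) -/

section Traces

variable {π : Type*} [Group π] (ρ : π →* SL(2, ℂ))

theorem elementTrace_mul_mul (u v : π) : elementTrace ρ (u * (u * v)) =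
    elementTrace ρ u * elementTrace ρ (u * v) - elementTrace ρ v := by
  have hA := (ρ u).det_coe
  rw [Matrix.det_fin_two] at hA
  simp only [elementTrace, map_mul, Matrix.SpecialLinearGroup.coe_mul, Matrix.trace_fin_two,
    Matrix.mul_apply, Fin.sum_univ_two]
  linear_combination -((ρ v : Matrix (Fin 2) (Fin 2) ℂ) 0 0 + (ρ v : Matrix (Fin 2) (Fin 2) ℂ) 1 1)
    * hA

theorem elementTrace_mul_comm (u v : π) : elementTrace ρ (u * v) = elementTrace ρ (v * u) :=
  elementTrace_of_isConj ρ (isConj_iff.2 ⟨u⁻¹, by group⟩)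

theorem elementTrace_mul_inv (u v : π) : elementTrace ρ (u * v⁻¹) =
    elementTrace ρ u * elementTrace ρ v - elementTrace ρ (u * v) := by
  have h := elementTrace_mul_mul ρ v (v⁻¹ * u)
  rw [mul_inv_cancel_left, elementTrace_mul_comm ρ v u, elementTrace_mul_comm ρ v⁻¹ u] at h
  rw [h]; ring

/-- The edge of traces that belongs to a pair of group elements. -/
def traceEdge (u v : π) : Edge := ⟨elementTrace ρ u, elementTrace ρ v, elementTrace ρ (u * v)⟩

theorem traceEdge_left (u v : π) : traceEdge ρ u (u * v) = (traceEdge ρ u v).left := by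
  simp [traceEdge, Edge.left, elementTrace_mul_mul]

theorem traceEdge_right (u v : π) : traceEdge ρ (u * v) v = (traceEdge ρ u v).right := by
  have h : elementTrace ρ (u * v * v) =
      elementTrace ρ (u * v) * elementTrace ρ v - elementTrace ρ u := by
    have h := elementTrace_mul_mul ρ v u
    rw [← mul_assoc, elementTrace_mul_comm ρ v u] at h
    rw [← mul_comm (elementTrace ρ v), ← h]
    exact elementTrace_of_isConj ρ (isConj_iff.2 ⟨v * v, by group⟩)
  simp [traceEdge, Edge.right, h]

theorem traceEdge_inv_right (u v : π) : traceEdge ρ u v⁻¹ = (traceEdge ρ u v).reverse := by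
  simp [traceEdge, Edge.reverse, Edge.back, elementTrace_mul_inv, elementTrace_inv]

theorem elementTrace_pairHead (u v : π) (w : List Bool) :
    elementTrace ρ (pairHead u v w) = ((traceEdge ρ u v).descend w).z := by
  induction w generalizing u v with
  | nil => rfl
  | cons s w ih =>
    cases s
    · rw [pairHead_false, ih, traceEdge_right, Edge.descend_false]
    · rw [pairHead_true, ih, traceEdge_left, Edge.descend_true]

/-- Fricke's identity. -/
theorem isMarkoff_traceEdge (u v : π) :
    (traceEdge ρ u v).IsMarkoff (elementTrace ρ (u * v * u⁻¹ * v⁻¹) + 2) := by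
  have hA := (ρ u).det_coe
  have hB := (ρ v).det_coe
  rw [Matrix.det_fin_two] at hA hB
  simp only [Edge.IsMarkoff, traceEdge, elementTrace, map_mul, map_inv,
    Matrix.SpecialLinearGroup.coe_mul, Matrix.SpecialLinearGroup.coe_inv, Matrix.adjugate_fin_two,
    Matrix.trace_fin_two, Matrix.mul_apply, Fin.sum_univ_two, Matrix.of_apply, Matrix.cons_val',
    Matrix.cons_val_zero, Matrix.cons_val_one, Matrix.cons_val_fin_one]
  generalize (ρ u : Matrix (Fin 2) (Fin 2) ℂ) = A at *
  generalize (ρ v : Matrix (Fin 2) (Fin 2) ℂ) = B at *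
  linear_combination
    -((A 0 0 + A 1 1) ^ 2 * hB) - (B 0 0 + B 1 1) ^ 2 * hA +
      2 * hA * (B 0 0 * B 1 1 - B 0 1 * B 1 0) + 2 * hB

end Traces

/-! ### Irreducibility excludes μ = 4 -/

section Irreducible

variable {π : Type*} [Group π] (b : FreeGroupBasis (Fin 2) π) {ρ : π →* SL(2, ℂ)}

/-- The inverse of a matrix A in SL(2) is tr A − A, so invariance under the two generators passes to
the whole group. -/
theorem eq_bot_or_eq_top_of_invariant (hirr : IsIrred ρ) (K : Submodule ℂ (Fin 2 → ℂ))
    (h : ∀ i, ∀ v ∈ K, (ρ (b i) : Matrix (Fin 2) (Fin 2) ℂ).mulVec v ∈ K) :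
    K = ⊥ ∨ K = ⊤ := by
  have hinv : ∀ (g : π) (v : Fin 2 → ℂ), (ρ g⁻¹ : Matrix (Fin 2) (Fin 2) ℂ).mulVec v =
      (ρ g : Matrix (Fin 2) (Fin 2) ℂ).trace • v -
        (ρ g : Matrix (Fin 2) (Fin 2) ℂ).mulVec v := by
    intro g v
    rw [map_inv, Matrix.SpecialLinearGroup.coe_inv, Matrix.adjugate_fin_two]
    ext i
    fin_cases i <;> simp [Matrix.mulVec, dotProduct, Matrix.trace_fin_two] <;> ring
  have hall : ∀ g, ∀ v ∈ K, (ρ g : Matrix (Fin 2) (Fin 2) ℂ).mulVec v ∈ K := by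
    intro g
    have hg : g ∈ Subgroup.closure {b 0, b 1} := by rw [closure_basis]; trivial
    induction hg using Subgroup.closure_induction with
    | mem x hx =>
      rcases hx with rfl | rfl
      · exact h 0
      · exact h 1
    | one => intro v hv; simpa using hv
    | mul x y _ _ hx hy =>
      intro v hv
      rw [map_mul, Matrix.SpecialLinearGroup.coe_mul, ← Matrix.mulVec_mulVec]
      exact hx _ (hy _ hv)
    | inv x _ hx =>
      intro v hv
      rw [hinv]
      exact K.sub_mem (K.smul_mem _ hv) (hx _ hv)
  let S : Subrepresentation (linearRep ρ) := ⟨K, fun g v hv => by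
    change Matrix.toLin' _ v ∈ K
    rw [Matrix.toLin'_apply]
    exact hall g v hv⟩
  have : IsSimpleOrder (Subrepresentation (linearRep ρ)) := hirr
  rcases eq_bot_or_eq_top S with hS | hS
  · left
    exact congrArg Subrepresentation.toSubmodule hS
  · right
    exact congrArg Subrepresentation.toSubmodule hS

/-- At trace 2 the matrix N = AB − BA is singular. Since NA = A⁻¹N and NB = B⁻¹N, its kernel is
invariant, so N = 0. By Schur's argument the commuting A and B are then scalar, and every line is
invariant. -/
theorem peripheralTrace_ne_two (hirr : IsIrred ρ) : peripheralTrace ρ b ≠ 2 := by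
  intro hτ
  have hA := (ρ (b 0)).det_coe
  have hB := (ρ (b 1)).det_coe
  have hM0 := isMarkoff_traceEdge ρ (b 0) (b 1)
  change (traceEdge ρ (b 0) (b 1)).IsMarkoff (peripheralTrace ρ b + 2) at hM0
  rw [hτ] at hM0
  simp only [Edge.IsMarkoff, traceEdge, elementTrace, map_mul,
    Matrix.SpecialLinearGroup.coe_mul] at hM0
  have hinv := eq_bot_or_eq_top_of_invariant b hirr
  generalize hAd : (ρ (b 0) : Matrix (Fin 2) (Fin 2) ℂ) = A at *
  generalize hBd : (ρ (b 1) : Matrix (Fin 2) (Fin 2) ℂ) = B at *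
  have hinv' : ∀ K : Submodule ℂ (Fin 2 → ℂ), (∀ v ∈ K, A.mulVec v ∈ K) →
      (∀ v ∈ K, B.mulVec v ∈ K) → K = ⊥ ∨ K = ⊤ := by
    intro K h0 h1
    refine hinv K fun i => ?_
    fin_cases i
    · simpa [hAd] using h0
    · simpa [hBd] using h1
  have key : ∀ N : Matrix (Fin 2) (Fin 2) ℂ, N.det = 0 →
      (∀ v, N.mulVec v = 0 → N.mulVec (A.mulVec v) = 0) →
      (∀ v, N.mulVec v = 0 → N.mulVec (B.mulVec v) = 0) → N = 0 := by
    intro N hN h0 h1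
    obtain ⟨v, hv, hNv⟩ := Matrix.exists_mulVec_eq_zero_iff.2 hN
    rcases hinv' (LinearMap.ker N.mulVecLin) (by simpa using h0) (by simpa using h1) with h | h
    · exact absurd ((LinearMap.ker_eq_bot'.1 h) v (by simpa using hNv)) hv
    · have := LinearMap.ker_eq_top.1 h
      exact Matrix.toLin'.injective (by rw [Matrix.toLin'_apply', this, map_zero])
  have hcomm : A * B - B * A = 0 := by
    apply key
    · rw [Matrix.det_fin_two] at *
      simp only [Matrix.trace_fin_two, Matrix.mul_apply, Fin.sum_univ_two, Matrix.sub_apply] at *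
      linear_combination -hM0 - (A 0 0 + A 1 1) ^ 2 * hB - (B 0 0 + B 1 1) ^ 2 * hA +
        4 * (hA * (B 0 0 * B 1 1 - B 0 1 * B 1 0) + hB)
    · intro v hv
      have h : (A * B - B * A) * A = (A.trace • 1 - A) * (A * B - B * A) := by
        ext i j
        fin_cases i <;> fin_cases j <;>
          simp [Matrix.mul_apply, Fin.sum_univ_two, Matrix.trace_fin_two, Matrix.sub_apply] <;> ring
      rw [Matrix.mulVec_mulVec, h, ← Matrix.mulVec_mulVec, hv, Matrix.mulVec_zero]
    · intro v hv
      have h : (A * B - B * A) * B = (B.trace • 1 - B) * (A * B - B * A) := by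
        ext i j
        fin_cases i <;> fin_cases j <;>
          simp [Matrix.mul_apply, Fin.sum_univ_two, Matrix.trace_fin_two, Matrix.sub_apply] <;> ring
      rw [Matrix.mulVec_mulVec, h, ← Matrix.mulVec_mulVec, hv, Matrix.mulVec_zero]
  have hscalar : ∀ C : Matrix (Fin 2) (Fin 2) ℂ, (A * C = C * A) → (B * C = C * B) →
      ∃ c : ℂ, C = c • 1 := by
    intro C h0 h1
    obtain ⟨c, hc⟩ := IsAlgClosed.exists_root
      (Polynomial.X ^ 2 - Polynomial.C C.trace * Polynomial.X + Polynomial.C C.det) (by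
        rw [show (Polynomial.X ^ 2 - Polynomial.C C.trace * Polynomial.X + Polynomial.C C.det :
          Polynomial ℂ) = Polynomial.C 1 * Polynomial.X ^ 2 + Polynomial.C (-C.trace) *
            Polynomial.X + Polynomial.C C.det by simp; ring]
        rw [Polynomial.degree_quadratic one_ne_zero]
        decide)
    simp only [Polynomial.IsRoot, Polynomial.eval_add, Polynomial.eval_sub, Polynomial.eval_pow,
      Polynomial.eval_X, Polynomial.eval_mul, Polynomial.eval_C] at hc
    refine ⟨c, sub_eq_zero.1 (key _ ?_ ?_ ?_)⟩
    · rw [Matrix.det_fin_two, Matrix.trace_fin_two] at hc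
      rw [Matrix.det_fin_two]
      simp
      linear_combination hc
    · intro v hv
      have h : (C - c • 1) * A = A * (C - c • 1) := by
        rw [sub_mul, mul_sub, h0]; simp
      rw [Matrix.mulVec_mulVec, h, ← Matrix.mulVec_mulVec, hv, Matrix.mulVec_zero]
    · intro v hv
      have h : (C - c • 1) * B = B * (C - c • 1) := by
        rw [sub_mul, mul_sub, h1]; simp
      rw [Matrix.mulVec_mulVec, h, ← Matrix.mulVec_mulVec, hv, Matrix.mulVec_zero]
  obtain ⟨α, hα⟩ := hscalar A rfl (sub_eq_zero.1 hcomm).symm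
  obtain ⟨β, hβ⟩ := hscalar B (sub_eq_zero.1 hcomm) rfl
  have hline : ∀ (c : ℂ) (v : Fin 2 → ℂ), v ∈ ℂ ∙ (![1, 0] : Fin 2 → ℂ) →
      (c • (1 : Matrix (Fin 2) (Fin 2) ℂ)).mulVec v ∈ ℂ ∙ (![1, 0] : Fin 2 → ℂ) := by
    intro c v hv
    rw [Matrix.smul_mulVec, Matrix.one_mulVec]
    exact Submodule.smul_mem _ _ hv
  rcases hinv' (ℂ ∙ (![1, 0] : Fin 2 → ℂ)) (by rw [hα]; exact hline α)
    (by rw [hβ]; exact hline β) with h | h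
  · rw [Submodule.span_singleton_eq_bot] at h
    simpa using congrFun h 0
  · have h1 : (![0, 1] : Fin 2 → ℂ) ∈ ℂ ∙ (![1, 0] : Fin 2 → ℂ) := h ▸ Submodule.mem_top
    obtain ⟨c, hc⟩ := Submodule.mem_span_singleton.1 h1
    simpa using congrFun hc 1

end Irreducible

end PuncturedTorus

namespace PuncturedTorus

open Filter Topology

/-! ### The square root that occurs in the identity -/

/-- `√(1 - 4 / x²)`. -/
noncomputable def rootFactor (x : ℂ) : ℂ := csqrt (1 - 4 / x ^ 2)

/-- The number is not in the real interval `[-2, 2]`. -/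
def NonElliptic (x : ℂ) : Prop := ¬ ∃ t : ℝ, t ∈ Set.Icc (-2 : ℝ) 2 ∧ x = (t : ℂ)

theorem NonElliptic.ne_zero {x : ℂ} (h : NonElliptic x) : x ≠ 0 := by
  rintro rfl
  exact h ⟨0, by simp, by simp⟩

theorem rootFactor_sq (x : ℂ) : rootFactor x ^ 2 = 1 - 4 / x ^ 2 := csqrt_sq _

/-- A purely imaginary root ir would give x²(1 + r²) = 4, which places x in [−2, 2]. -/
theorem NonElliptic.rootFactor_re_pos {x : ℂ} (h : NonElliptic x) : 0 < (rootFactor x).re := by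
  refine lt_of_le_of_ne (csqrt_re_nonneg _) fun h0 => h ?_
  change 0 = (rootFactor x).re at h0
  have hx := h.ne_zero
  set r := (rootFactor x).im
  have hs : rootFactor x = r * Complex.I := by
    apply Complex.ext <;> simp [← h0, r]
  have h1 := rootFactor_sq x
  rw [hs, mul_pow, Complex.I_sq] at h1
  have h2 : x ^ 2 * ((1 + r ^ 2 : ℝ) : ℂ) = 4 := by
    push_cast
    field_simp at h1
    linear_combination -h1
  have hpos : (0 : ℝ) < 1 + r ^ 2 := by positivity
  set q := Real.sqrt (1 + r ^ 2) with hq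
  have hq2 : q ^ 2 = 1 + r ^ 2 := Real.sq_sqrt hpos.le
  have hq1 : 1 ≤ q := by
    rw [hq]; exact Real.one_le_sqrt.2 (by nlinarith)
  have h3 : (x * q - 2) * (x * q + 2) = 0 := by
    rw [← hq2] at h2
    push_cast at h2
    linear_combination h2
  have hq0 : (q : ℂ) ≠ 0 := by exact_mod_cast (by linarith : q ≠ 0)
  have h4 : 2 / q ≤ 2 := by
    rw [div_le_iff₀ (by linarith)]; linarith
  have h5 : 0 ≤ 2 / q := by positivity
  rcases mul_eq_zero.1 h3 with h | h
  · refine ⟨2 / q, ⟨by linarith, h4⟩, ?_⟩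
    push_cast
    rw [eq_div_iff hq0]
    linear_combination h
  · refine ⟨-(2 / q), ⟨by linarith, by linarith⟩, ?_⟩
    push_cast
    rw [← neg_div, eq_div_iff hq0]
    linear_combination h

theorem norm_one_sub_rootFactor_le (x : ℂ) :
    ‖(1 - rootFactor x) / 2‖ ≤ 2 * (1 / ‖x‖ ^ 2) := by
  have h1 : (1 - rootFactor x) * (1 + rootFactor x) = 4 / x ^ 2 := by
    linear_combination -rootFactor_sq x
  have h2 : 1 ≤ ‖1 + rootFactor x‖ := by
    refine le_trans ?_ (Complex.re_le_norm _)
    have : 0 ≤ (rootFactor x).re := csqrt_re_nonneg _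
    simpa using this
  have h3 : ‖1 - rootFactor x‖ * ‖1 + rootFactor x‖ = 4 / ‖x‖ ^ 2 := by
    rw [← norm_mul, h1]; simp
  rw [norm_div, Complex.norm_ofNat]
  have h4 : ‖1 - rootFactor x‖ ≤ 4 / ‖x‖ ^ 2 := by
    rw [← h3]
    exact le_mul_of_one_le_right (norm_nonneg _) h2
  calc ‖1 - rootFactor x‖ / 2 ≤ (4 / ‖x‖ ^ 2) / 2 := by gcongr
    _ = _ := by ring

/-! ### The gap of an edge -/

/-- The total contribution to the identity of the regions ahead of an edge. -/
noncomputable def gap (μ : ℂ) (e : Edge) : ℂ :=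
  e.back / (e.x * e.y) - (1 - rootFactor e.x) / 2 - (1 - rootFactor e.y) / 2 +
    μ / 3 * ((e.back / (e.x * e.y) - (1 - rootFactor e.x) / 2) / (e.x ^ 2 - μ) +
      (e.back / (e.x * e.y) - (1 - rootFactor e.y) / 2) / (e.y ^ 2 - μ))

variable {μ : ℂ} {e : Edge}

theorem gap_swap (μ : ℂ) (e : Edge) : gap μ e.swap = gap μ e := by
  simp only [gap, Edge.back_swap]
  simp only [Edge.swap]
  rw [mul_comm e.y e.x]
  ring

theorem hMu_eq {x : ℂ} (hx : x ^ 2 ≠ μ) : hMu μ x =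
    (1 - rootFactor x) / 2 - μ / 6 * (rootFactor x / (x ^ 2 - μ)) := by
  have := sub_ne_zero.2 hx
  simp only [hMu, rootFactor]
  field_simp
  ring

/-- The Markoff equation gives y/(xz) + x/(yz) = back/(xy) + μ/(xyz). It also gives back/(xy) =
y/(xz) + (x² − μ)/(xyz) and its analogues, so each of the three quotients weighted by μ/3 shifts by
1/(xyz); together they absorb the defect μ/(xyz). -/
theorem gap_left_add_gap_right (hM : e.IsMarkoff μ) (hx : e.x ≠ 0) (hy : e.y ≠ 0) (hz : e.z ≠ 0)
    (hxμ : e.x ^ 2 ≠ μ) (hyμ : e.y ^ 2 ≠ μ) (hzμ : e.z ^ 2 ≠ μ) :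
    gap μ e.left + gap μ e.right = gap μ e - 2 * hMu μ e.z := by
  rw [hMu_eq hzμ]
  simp only [gap, Edge.back_left, Edge.back_right]
  simp only [Edge.left, Edge.right, Edge.back]
  unfold Edge.IsMarkoff at hM
  generalize rootFactor e.x = s
  generalize rootFactor e.y = t
  generalize rootFactor e.z = u
  obtain ⟨x, y, z⟩ := e
  simp only at *
  have hx' := sub_ne_zero.2 hxμ
  have hy' := sub_ne_zero.2 hyμ
  have hz' := sub_ne_zero.2 hzμ
  have h1 : (x * y - z) / (x * y) = y / (x * z) + (x ^ 2 - μ) * (1 / (x * y * z)) := by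
    field_simp
    linear_combination -hM
  have h2 : (x * y - z) / (x * y) = x / (z * y) + (y ^ 2 - μ) * (1 / (x * y * z)) := by
    field_simp
    linear_combination -hM
  have h3 : x / (z * y) = 1 - (z ^ 2 - μ) * (1 / (x * y * z)) - y / (x * z) := by
    field_simp
    linear_combination hM
  have e1 : ((x * y - z) / (x * y) - (1 - s) / 2) / (x ^ 2 - μ) =
      (y / (x * z) - (1 - s) / 2) / (x ^ 2 - μ) + 1 / (x * y * z) := by
    rw [h1]; field_simp; ring
  have e2 : ((x * y - z) / (x * y) - (1 - t) / 2) / (y ^ 2 - μ) =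
      (x / (z * y) - (1 - t) / 2) / (y ^ 2 - μ) + 1 / (x * y * z) := by
    rw [h2]; field_simp; ring
  have e3 : (x / (z * y) - (1 - u) / 2) / (z ^ 2 - μ) =
      u / (z ^ 2 - μ) - (y / (x * z) - (1 - u) / 2) / (z ^ 2 - μ) - 1 / (x * y * z) := by
    rw [h3]; field_simp; ring
  rw [e1, e2, e3]
  have h4 : y / (x * z) + x / (z * y) = (x * y - z) / (x * y) + μ * (1 / (x * y * z)) := by
    field_simp
    linear_combination hM
  linear_combination h4

theorem gap_add_gap_reverse (hx : e.x ≠ 0) (hy : e.y ≠ 0)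
    (hxμ : e.x ^ 2 ≠ μ) (hyμ : e.y ^ 2 ≠ μ) :
    gap μ e + gap μ e.reverse = 1 - 2 * hMu μ e.x - 2 * hMu μ e.y := by
  rw [hMu_eq hxμ, hMu_eq hyμ]
  simp only [gap]
  simp only [Edge.reverse, Edge.back]
  generalize rootFactor e.x = s
  generalize rootFactor e.y = t
  obtain ⟨x, y, z⟩ := e
  simp only at *
  have hx' := sub_ne_zero.2 hxμ
  have hy' := sub_ne_zero.2 hyμ
  have h : (x * y - z) / (x * y) = 1 - z / (x * y) := by field_simp
  have h' : (x * y - (x * y - z)) / (x * y) = z / (x * y) := by congr 1; ring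
  rw [h, h']
  generalize z / (x * y) = p
  field_simp
  ring

/-! ### Estimates -/

/-- Put t = (z − back)/(xy) and s = √(1 − 4/x²). The quantity is |s − t|/2, and (s − t)(s + t) = 4(1
− μ/x²)/y² by the Markoff equation. The growth hypothesis gives Re t ≥ 0, hence |s + t| ≥ Re s. -/
theorem norm_back_div_sub_le (hM : e.IsMarkoff μ) (hx : e.x ≠ 0) (hy : e.y ≠ 0)
    (hs : 0 < (rootFactor e.x).re) (hgrow : ‖e.back‖ ≤ ‖e.z‖) :
    ‖e.back / (e.x * e.y) - (1 - rootFactor e.x) / 2‖ ≤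
      2 * ‖1 - μ / e.x ^ 2‖ * (1 / (rootFactor e.x).re) * (1 / ‖e.y‖ ^ 2) := by
  set s := rootFactor e.x with hsdef
  set t := (e.z - e.back) / (e.x * e.y) with ht
  have hxy : e.x * e.y = e.z + e.back := by simp [Edge.back]
  have hxy0 : e.z + e.back ≠ 0 := hxy ▸ mul_ne_zero hx hy
  have ht0 : 0 ≤ t.re := by
    rw [ht, hxy, Complex.div_re, ← add_div]
    apply div_nonneg _ (Complex.normSq_nonneg _)
    have h1 : ‖e.back‖ ^ 2 ≤ ‖e.z‖ ^ 2 := by gcongr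
    rw [← Complex.normSq_eq_norm_sq, ← Complex.normSq_eq_norm_sq, Complex.normSq_apply,
      Complex.normSq_apply] at h1
    simp only [Complex.sub_re, Complex.sub_im, Complex.add_re, Complex.add_im]
    linarith
  have h1 : e.back / (e.x * e.y) - (1 - s) / 2 = (s - t) / 2 := by
    rw [ht]
    field_simp
    rw [hxy]
    ring
  have h2 : (s - t) * (s + t) = 4 * (1 - μ / e.x ^ 2) / e.y ^ 2 := by
    have h3 : (s - t) * (s + t) = (1 - 4 / e.x ^ 2) - t ^ 2 := by
      rw [← rootFactor_sq]; ring
    rw [h3, ht]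
    unfold Edge.IsMarkoff at hM
    simp only [Edge.back]
    field_simp
    linear_combination (-4) * hM
  have h3 : s.re ≤ ‖s + t‖ := by
    refine le_trans ?_ (Complex.re_le_norm _)
    simpa using ht0
  have h4 : ‖s - t‖ * ‖s + t‖ = 4 * ‖1 - μ / e.x ^ 2‖ / ‖e.y‖ ^ 2 := by
    rw [← norm_mul, h2]; simp
  have h5 : ‖s - t‖ * s.re ≤ 4 * ‖1 - μ / e.x ^ 2‖ / ‖e.y‖ ^ 2 := by
    rw [← h4]; gcongr
  rw [h1, norm_div, Complex.norm_ofNat]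
  rw [← le_div_iff₀ hs] at h5
  calc ‖s - t‖ / 2 ≤ (4 * ‖1 - μ / e.x ^ 2‖ / ‖e.y‖ ^ 2 / s.re) / 2 := by gcongr
    _ = _ := by ring

/-- Uniform bounds for the quantities that occur in the estimates of the gap. -/
structure IsRegular (μ : ℂ) (C : ℝ) (x : ℂ) : Prop where
  ne_zero : x ≠ 0
  sq_ne : x ^ 2 ≠ μ
  root_pos : 0 < (rootFactor x).re
  root_le : 1 / (rootFactor x).re ≤ C
  one_sub_le : ‖1 - μ / x ^ 2‖ ≤ C
  ratio_le : ‖x ^ 2 / (x ^ 2 - μ)‖ ≤ C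
  inv_le : 1 / ‖x‖ ^ 2 ≤ C

theorem IsRegular.norm_inv_le {C : ℝ} {x : ℂ} (h : IsRegular μ C x) :
    ‖(x ^ 2 - μ)⁻¹‖ ≤ C * (1 / ‖x‖ ^ 2) := by
  have hx := h.ne_zero
  have h1 : (x ^ 2 - μ)⁻¹ = x ^ 2 / (x ^ 2 - μ) * (1 / x ^ 2) := by
    have := sub_ne_zero.2 h.sq_ne
    field_simp
  rw [h1, norm_mul]
  have h2 : ‖(1 : ℂ) / x ^ 2‖ = 1 / ‖x‖ ^ 2 := by simp
  rw [h2]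
  exact mul_le_mul_of_nonneg_right h.ratio_le (by positivity)

/-- By summability the values tend to infinity, so each quantity converges along the cofinite filter
and is therefore bounded. -/
theorem exists_isRegular {ι : Type*} {v : ι → ℂ} (hv : ∀ i, NonElliptic (v i))
    (hvμ : ∀ i, v i ^ 2 ≠ μ) (hs : Summable fun i => 1 / ‖v i‖ ^ 2) :
    ∃ C, ∀ i, IsRegular μ C (v i) := by
  have h0 : Tendsto (fun i => 1 / ‖v i‖ ^ 2) cofinite (𝓝 0) := hs.tendsto_cofinite_zero
  have h1 : Tendsto (fun i => 1 / v i ^ 2) cofinite (𝓝 0) := by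
    rw [tendsto_zero_iff_norm_tendsto_zero]
    simpa using h0
  have hroot : Tendsto (fun i => rootFactor (v i)) cofinite (𝓝 1) := by
    have hc : ContinuousAt csqrt 1 := by
      unfold csqrt
      exact continuousAt_id.cpow continuousAt_const (by simp)
    have h2 : Tendsto (fun i => 1 - 4 / v i ^ 2) cofinite (𝓝 1) := by
      have := (h1.const_mul 4).const_sub 1
      simpa [div_eq_mul_inv] using this
    have h3 : csqrt 1 = 1 := by simp [csqrt]
    have := hc.tendsto.comp h2
    rw [h3] at this
    exact this
  have hre : Tendsto (fun i => 1 / (rootFactor (v i)).re) cofinite (𝓝 1) := by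
    have h2 : Tendsto (fun i => (rootFactor (v i)).re) cofinite (𝓝 1) := by
      exact (Complex.continuous_re.tendsto 1).comp hroot
    simpa using h2.inv₀ one_ne_zero
  have hsub : Tendsto (fun i => 1 - μ / v i ^ 2) cofinite (𝓝 1) := by
    have := (h1.const_mul μ).const_sub 1
    simpa [div_eq_mul_inv] using this
  have hratio : Tendsto (fun i => v i ^ 2 / (v i ^ 2 - μ)) cofinite (𝓝 1) := by
    have h2 := hsub.inv₀ one_ne_zero
    rw [inv_one] at h2
    refine h2.congr fun i => ?_
    have h3 := (hv i).ne_zero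
    have h4 := sub_ne_zero.2 (hvμ i)
    have h5 : 1 - μ / v i ^ 2 = (v i ^ 2 - μ) / v i ^ 2 := by field_simp
    rw [h5, inv_div]
  obtain ⟨C1, hC1⟩ := hre.bddAbove_range_of_cofinite
  obtain ⟨C2, hC2⟩ := hsub.norm.bddAbove_range_of_cofinite
  obtain ⟨C3, hC3⟩ := hratio.norm.bddAbove_range_of_cofinite
  obtain ⟨C4, hC4⟩ := h0.bddAbove_range_of_cofinite
  refine ⟨max (max C1 C2) (max C3 C4), fun i =>
    ⟨(hv i).ne_zero, hvμ i, (hv i).rootFactor_re_pos, ?_, ?_, ?_, ?_⟩⟩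
  · exact (hC1 ⟨i, rfl⟩).trans (by simp)
  · exact (hC2 ⟨i, rfl⟩).trans (by simp)
  · exact (hC3 ⟨i, rfl⟩).trans (by simp)
  · exact (hC4 ⟨i, rfl⟩).trans (by simp)

theorem norm_gap_le_right {C : ℝ} (hM : e.IsMarkoff μ) (hx : IsRegular μ C e.x)
    (hy : IsRegular μ C e.y) (hgrow : ‖e.back‖ ≤ ‖e.z‖) :
    ‖gap μ e‖ ≤ (2 * C ^ 2 + 2 + ‖μ‖ / 3 * (4 * C ^ 4)) * (1 / ‖e.y‖ ^ 2) := by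
  have hC : 0 ≤ C := le_trans (by positivity) hx.inv_le
  set nx := 1 / ‖e.x‖ ^ 2 with hnx
  set ny := 1 / ‖e.y‖ ^ 2 with hny
  have hnx0 : 0 ≤ nx := by positivity
  have hny0 : 0 ≤ ny := by positivity
  have hdx : ‖e.back / (e.x * e.y) - (1 - rootFactor e.x) / 2‖ ≤ 2 * C * C * ny := by
    refine (norm_back_div_sub_le hM hx.ne_zero hy.ne_zero hx.root_pos hgrow).trans ?_
    have h1 := hx.one_sub_le
    have h2 := hx.root_le
    have h3 : 0 ≤ 1 / (rootFactor e.x).re := by have := hx.root_pos; positivity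
    gcongr
  have hdy : ‖e.back / (e.x * e.y) - (1 - rootFactor e.y) / 2‖ ≤ 2 * C * C * nx := by
    have := norm_back_div_sub_le hM.swap hy.ne_zero hx.ne_zero hy.root_pos
      (by rw [Edge.back_swap]; exact hgrow)
    simp only [Edge.back_swap] at this
    simp only [Edge.swap] at this
    rw [mul_comm e.y e.x] at this
    refine this.trans ?_
    have h1 := hy.one_sub_le
    have h2 := hy.root_le
    have h3 : 0 ≤ 1 / (rootFactor e.y).re := by have := hy.root_pos; positivity
    gcongr
  have hhy := norm_one_sub_rootFactor_le e.y
  have hix := hx.norm_inv_le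
  have hiy := hy.norm_inv_le
  have hnxC : nx ≤ C := hx.inv_le
  set dx := e.back / (e.x * e.y) - (1 - rootFactor e.x) / 2 with hdxd
  set dy := e.back / (e.x * e.y) - (1 - rootFactor e.y) / 2
  have hg : gap μ e = dx - (1 - rootFactor e.y) / 2 +
      μ / 3 * (dx * (e.x ^ 2 - μ)⁻¹ + dy * (e.y ^ 2 - μ)⁻¹) := rfl
  rw [hg]
  calc ‖dx - (1 - rootFactor e.y) / 2 +
        μ / 3 * (dx * (e.x ^ 2 - μ)⁻¹ + dy * (e.y ^ 2 - μ)⁻¹)‖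
      ≤ ‖dx‖ + ‖(1 - rootFactor e.y) / 2‖ +
        ‖μ‖ / 3 * (‖dx‖ * ‖(e.x ^ 2 - μ)⁻¹‖ + ‖dy‖ * ‖(e.y ^ 2 - μ)⁻¹‖) := by
        refine (norm_add_le _ _).trans (add_le_add (norm_sub_le _ _) ?_)
        rw [norm_mul, norm_div, Complex.norm_ofNat]
        refine mul_le_mul_of_nonneg_left ?_ (by positivity)
        refine (norm_add_le _ _).trans ?_
        rw [norm_mul, norm_mul]
    _ ≤ 2 * C * C * ny + 2 * ny +
        ‖μ‖ / 3 * (2 * C * C * ny * (C * C) + 2 * C * C * C * (C * ny)) := by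
        gcongr
        · exact hix.trans (by gcongr)
        · exact hdy.trans (by gcongr)
    _ = _ := by ring

theorem norm_gap_le_left {C : ℝ} (hM : e.IsMarkoff μ) (hx : IsRegular μ C e.x)
    (hy : IsRegular μ C e.y) (hgrow : ‖e.back‖ ≤ ‖e.z‖) :
    ‖gap μ e‖ ≤ (2 * C ^ 2 + 2 + ‖μ‖ / 3 * (4 * C ^ 4)) * (1 / ‖e.x‖ ^ 2) := by
  rw [← gap_swap]
  exact norm_gap_le_right hM.swap hy hx (by rw [Edge.back_swap]; exact hgrow)

theorem norm_hMu_le {C : ℝ} {x : ℂ} (hx : IsRegular μ C x) :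
    ‖hMu μ x‖ ≤ (2 + ‖μ‖ / 6 * ((1 + 4 * C) * C)) * (1 / ‖x‖ ^ 2) := by
  have hC : 0 ≤ C := le_trans (by positivity) hx.inv_le
  have h1 := norm_one_sub_rootFactor_le x
  have h2 : ‖rootFactor x‖ ≤ 1 + 4 * C := by
    have h3 : rootFactor x = 1 - 2 * ((1 - rootFactor x) / 2) := by ring
    have h4 := hx.inv_le
    calc ‖rootFactor x‖ ≤ ‖(1 : ℂ)‖ + ‖2 * ((1 - rootFactor x) / 2)‖ := by
          conv_lhs => rw [h3]
          exact norm_sub_le _ _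
      _ ≤ 1 + 2 * (2 * (1 / ‖x‖ ^ 2)) := by
          rw [norm_one, norm_mul, Complex.norm_ofNat]; gcongr
      _ ≤ 1 + 4 * C := by linarith
  have h3 := hx.norm_inv_le
  rw [hMu_eq hx.sq_ne]
  calc ‖(1 - rootFactor x) / 2 - μ / 6 * (rootFactor x / (x ^ 2 - μ))‖
      ≤ ‖(1 - rootFactor x) / 2‖ + ‖μ‖ / 6 * (‖rootFactor x‖ * ‖(x ^ 2 - μ)⁻¹‖) := by
        refine (norm_sub_le _ _).trans (add_le_add le_rfl ?_)
        rw [div_eq_mul_inv (rootFactor x), norm_mul, norm_mul, norm_div, Complex.norm_ofNat]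
    _ ≤ 2 * (1 / ‖x‖ ^ 2) + ‖μ‖ / 6 * ((1 + 4 * C) * (C * (1 / ‖x‖ ^ 2))) := by gcongr
    _ = _ := by ring

end PuncturedTorus

namespace PuncturedTorus

open Filter Topology

/-! ### Sums over the binary tree -/

/-- The words of a given length. -/
def wordsOfLength : ℕ → Finset (List Bool)
  | 0 => {[]}
  | n + 1 => (wordsOfLength n).image (List.cons true) ∪ (wordsOfLength n).image (List.cons false)

theorem mem_wordsOfLength {n : ℕ} {w : List Bool} : w ∈ wordsOfLength n ↔ w.length = n := by
  induction n generalizing w with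
  | zero => simp [wordsOfLength]
  | succ n ih =>
    rcases w with _ | ⟨s, w⟩
    · simp [wordsOfLength]
    · cases s <;> simp [wordsOfLength, ih]

theorem sum_wordsOfLength_succ {M : Type*} [AddCommMonoid M] (n : ℕ) (f : List Bool → M) :
    ∑ w ∈ wordsOfLength (n + 1), f w =
      ∑ w ∈ wordsOfLength n, f (true :: w) + ∑ w ∈ wordsOfLength n, f (false :: w) := by
  rw [wordsOfLength, Finset.sum_union, Finset.sum_image, Finset.sum_image]
  · intro a _ b _ h; simpa using h
  · intro a _ b _ h; simpa using h
  · rw [Finset.disjoint_left]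
    intro w h1 h2
    obtain ⟨a, _, rfl⟩ := Finset.mem_image.1 h1
    obtain ⟨b, _, h⟩ := Finset.mem_image.1 h2
    simp at h

theorem sum_wordsOfLength_succ' {M : Type*} [AddCommMonoid M] (n : ℕ) (f : List Bool → M) :
    ∑ w ∈ wordsOfLength (n + 1), f w =
      ∑ w ∈ wordsOfLength n, (f (w ++ [true]) + f (w ++ [false])) := by
  induction n generalizing f with
  | zero => simp [wordsOfLength]
  | succ n ih =>
    rw [sum_wordsOfLength_succ, ih, ih, sum_wordsOfLength_succ n]
    rfl

theorem tendsto_sum_wordsOfLength {E : Type*} [AddCommMonoid E] [TopologicalSpace E]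
    {f : List Bool → E} {a : E} (hf : HasSum f a) :
    Tendsto (fun n => ∑ k ∈ Finset.range n, ∑ w ∈ wordsOfLength k, f w) atTop (𝓝 a) := by
  have h1 : Tendsto (fun n => (Finset.range n).biUnion wordsOfLength) atTop atTop := by
    refine tendsto_atTop_finset_of_monotone (fun m n hmn => ?_) fun w => ⟨w.length + 1, ?_⟩
    · exact Finset.biUnion_subset_biUnion_of_subset_left _ (Finset.range_mono hmn)
    · exact Finset.mem_biUnion.2 ⟨w.length, by simp, mem_wordsOfLength.2 rfl⟩
  refine (hf.comp h1).congr fun n => ?_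
  simp only [Function.comp]
  apply Finset.sum_biUnion
  intro i _ j _ hij
  rw [Function.onFun, Finset.disjoint_left]
  intro w h1 h2
  exact hij ((mem_wordsOfLength.1 h1).symm.trans (mem_wordsOfLength.1 h2))

theorem tendsto_sum_wordsOfLength_zero {f : List Bool → ℝ} (hf : Summable f) :
    Tendsto (fun n => ∑ w ∈ wordsOfLength n, f w) atTop (𝓝 0) := by
  have h1 := tendsto_sum_wordsOfLength hf.hasSum
  have h2 := (tendsto_add_atTop_iff_nat 1).2 h1
  have h3 := h2.sub h1
  simp only [Finset.sum_range_succ, add_sub_cancel_left, sub_self] at h3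
  exact h3

/-- The decomposition of the words into the empty word and the words with a given first letter. -/
def wordEquiv : List Bool ≃ Unit ⊕ (List Bool ⊕ List Bool) where
  toFun
    | [] => .inl ()
    | true :: w => .inr (.inl w)
    | false :: w => .inr (.inr w)
  invFun
    | .inl _ => []
    | .inr (.inl w) => true :: w
    | .inr (.inr w) => false :: w
  left_inv w := by rcases w with _ | ⟨_ | _, w⟩ <;> rfl
  right_inv i := by rcases i with _ | _ | _ <;> rfl

theorem hasSum_words {f : List Bool → ℂ} {a c : ℂ} (ha : HasSum (fun w => f (true :: w)) a)
    (hc : HasSum (fun w => f (false :: w)) c) : HasSum f (f [] + (a + c)) := by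
  rw [← wordEquiv.symm.hasSum_iff]
  refine HasSum.sum (f := f ∘ wordEquiv.symm) ?_ (HasSum.sum ?_ ?_)
  · exact hasSum_unique (fun _ : Unit => f [])
  · exact ha
  · exact hc

/-! ### Edges whose gap is filled by the regions ahead -/

/-- The gap of the edge is the sum of the contributions of the regions ahead. -/
def IsFilled (μ : ℂ) (e : Edge) : Prop :=
  HasSum (fun w => 2 * hMu μ (e.descend w).z) (gap μ e)

/-- The properties of an edge that follow from the Bowditch conditions. -/
structure IsAdmissible (μ : ℂ) (e : Edge) : Prop where
  isMarkoff : e.IsMarkoff μ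
  left_nonElliptic : NonElliptic e.x
  right_nonElliptic : NonElliptic e.y
  head_nonElliptic : ∀ w, NonElliptic (e.descend w).z
  left_sq_ne : e.x ^ 2 ≠ μ
  right_sq_ne : e.y ^ 2 ≠ μ
  head_sq_ne : ∀ w, (e.descend w).z ^ 2 ≠ μ

variable {μ : ℂ} {e : Edge}

theorem IsAdmissible.left (h : IsAdmissible μ e) : IsAdmissible μ e.left where
  isMarkoff := h.isMarkoff.left
  left_nonElliptic := h.left_nonElliptic
  right_nonElliptic := h.head_nonElliptic []
  head_nonElliptic w := h.head_nonElliptic (true :: w)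
  left_sq_ne := h.left_sq_ne
  right_sq_ne := h.head_sq_ne []
  head_sq_ne w := h.head_sq_ne (true :: w)

theorem IsAdmissible.right (h : IsAdmissible μ e) : IsAdmissible μ e.right where
  isMarkoff := h.isMarkoff.right
  left_nonElliptic := h.head_nonElliptic []
  right_nonElliptic := h.right_nonElliptic
  head_nonElliptic w := h.head_nonElliptic (false :: w)
  left_sq_ne := h.head_sq_ne []
  right_sq_ne := h.right_sq_ne
  head_sq_ne w := h.head_sq_ne (false :: w)

theorem IsAdmissible.swap (h : IsAdmissible μ e) : IsAdmissible μ e.swap where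
  isMarkoff := h.isMarkoff.swap
  left_nonElliptic := h.right_nonElliptic
  right_nonElliptic := h.left_nonElliptic
  head_nonElliptic w := by rw [Edge.descend_swap]; exact h.head_nonElliptic _
  left_sq_ne := h.right_sq_ne
  right_sq_ne := h.left_sq_ne
  head_sq_ne w := by rw [Edge.descend_swap]; exact h.head_sq_ne _

theorem IsFilled.of_swap (h : IsFilled μ e.swap) : IsFilled μ e := by
  unfold IsFilled at *
  rw [gap_swap] at h
  have hnot : ∀ w : List Bool, (w.map not).map not = w := fun w => by
    induction w with
    | nil => rfl
    | cons s w ih => simp only [List.map_cons, Bool.not_not, ih]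
  let σ : List Bool ≃ List Bool := ⟨List.map not, List.map not, hnot, hnot⟩
  rw [← σ.hasSum_iff]
  convert h using 2
  rw [Edge.descend_swap]
  rfl

theorem IsAdmissible.isFilled (h : IsAdmissible μ e) (hl : IsFilled μ e.left)
    (hr : IsFilled μ e.right) : IsFilled μ e := by
  have hsum := hasSum_words (f := fun w => 2 * hMu μ (e.descend w).z) hl hr
  have hgap := gap_left_add_gap_right h.isMarkoff h.left_nonElliptic.ne_zero
    h.right_nonElliptic.ne_zero (h.head_nonElliptic []).ne_zero h.left_sq_ne h.right_sq_ne
    (h.head_sq_ne [])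
  unfold IsFilled
  convert hsum using 1
  rw [hgap]
  simp

theorem Edge.forall_sides {P : ℂ → Prop} (hx : P e.x) (hy : P e.y)
    (hz : ∀ w, P (e.descend w).z) (w : List Bool) :
    P (e.descend w).x ∧ P (e.descend w).y := by
  induction w generalizing e with
  | nil => exact ⟨hx, hy⟩
  | cons s w ih =>
    cases s
    · exact ih (hz []) hy fun w => hz (false :: w)
    · exact ih hx (hz []) fun w => hz (true :: w)

/-- The gap is filled if all the edges ahead point away from the edge and if the sum of the inverse
squares of the values converges. -/
theorem IsAdmissible.isFilled_of_growing (h : IsAdmissible μ e)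
    (hgrow : ∀ w, ‖(e.descend w).back‖ ≤ ‖(e.descend w).z‖)
    (hsum : Summable fun w => 1 / ‖(e.descend w).z‖ ^ 2) : IsFilled μ e := by
  obtain ⟨C, hC⟩ : ∃ C, ∀ i : Bool ⊕ List Bool, IsRegular μ C
      (Sum.elim (fun s => cond s e.x e.y) (fun w => (e.descend w).z) i) := by
    apply exists_isRegular
    · rintro ((_ | _) | w)
      exacts [h.right_nonElliptic, h.left_nonElliptic, h.head_nonElliptic w]
    · rintro ((_ | _) | w)
      exacts [h.right_sq_ne, h.left_sq_ne, h.head_sq_ne w]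
    · exact (HasSum.sum (f := fun i : Bool ⊕ List Bool => 1 /
        ‖Sum.elim (fun s => cond s e.x e.y) (fun w => (e.descend w).z) i‖ ^ 2)
        (hasSum_fintype _) hsum.hasSum).summable
  have hCz : ∀ w, IsRegular μ C (e.descend w).z := fun w => hC (.inr w)
  have hCxy := fun w => Edge.forall_sides (P := IsRegular μ C) (hC (.inl true)) (hC (.inl false))
    hCz w
  set K := 2 * C ^ 2 + 2 + ‖μ‖ / 3 * (4 * C ^ 4)
  have hS : Summable fun w => 2 * hMu μ (e.descend w).z := by
    apply Summable.mul_left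
    exact Summable.of_norm_bounded (hsum.mul_left _) fun w => norm_hMu_le (hCz w)
  have hstep : ∀ n, ∑ w ∈ wordsOfLength (n + 1), gap μ (e.descend w) =
      ∑ w ∈ wordsOfLength n, gap μ (e.descend w) -
        ∑ w ∈ wordsOfLength n, 2 * hMu μ (e.descend w).z := by
    intro n
    rw [sum_wordsOfLength_succ', ← Finset.sum_sub_distrib]
    refine Finset.sum_congr rfl fun w _ => ?_
    rw [Edge.descend_append, Edge.descend_append]
    exact gap_left_add_gap_right (h.isMarkoff.descend w) (hCxy w).1.ne_zero (hCxy w).2.ne_zero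
      (hCz w).ne_zero (hCxy w).1.sq_ne (hCxy w).2.sq_ne (hCz w).sq_ne
  have hpartial : ∀ n, ∑ k ∈ Finset.range n, ∑ w ∈ wordsOfLength k, 2 * hMu μ (e.descend w).z =
      gap μ e - ∑ w ∈ wordsOfLength n, gap μ (e.descend w) := by
    intro n
    induction n with
    | zero => simp [wordsOfLength]
    | succ n ih => rw [Finset.sum_range_succ, ih, hstep]; ring
  -- An edge at depth n + 1 has the head of its parent as a side, and its gap is at most K over the
  -- squared modulus of that value. Two children per parent give 2K times a level sum of a
  -- convergent series.
  have hzero : Tendsto (fun n => ∑ w ∈ wordsOfLength (n + 1), gap μ (e.descend w)) atTop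
      (𝓝 0) := by
    have h1 := tendsto_sum_wordsOfLength_zero (hsum.mul_left (2 * K))
    refine squeeze_zero_norm (fun n => ?_) h1
    rw [sum_wordsOfLength_succ']
    refine (norm_sum_le _ _).trans (Finset.sum_le_sum fun w _ => ?_)
    have hl := norm_gap_le_right (h.isMarkoff.descend (w ++ [true])) (hCxy _).1 (hCxy _).2
      (hgrow _)
    have hr := norm_gap_le_left (h.isMarkoff.descend (w ++ [false])) (hCxy _).1 (hCxy _).2
      (hgrow _)
    have e1 : (e.descend (w ++ [true])).y = (e.descend w).z := by
      rw [Edge.descend_append]; rfl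
    have e2 : (e.descend (w ++ [false])).x = (e.descend w).z := by
      rw [Edge.descend_append]; rfl
    rw [e1] at hl
    rw [e2] at hr
    change _ ≤ K * _ at hl
    change _ ≤ K * _ at hr
    refine (norm_add_le _ _).trans ?_
    linarith
  have h1 := tendsto_sum_wordsOfLength hS.hasSum
  have h2 : Tendsto (fun n => ∑ k ∈ Finset.range n, ∑ w ∈ wordsOfLength k,
      2 * hMu μ (e.descend w).z) atTop (𝓝 (gap μ e - 0)) := by
    simp only [hpartial]
    exact tendsto_const_nhds.sub ((tendsto_add_atTop_iff_nat 1).1 hzero)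
  rw [sub_zero] at h2
  have := hS.hasSum
  rwa [tendsto_nhds_unique h1 h2] at this

/-- Distinct words have distinct Farey coordinates, so the series is dominated by a product of two
geometric series. -/
theorem summable_of_farey_growth {α β : ℝ} (hα : 0 < α) (hβ : 0 < β) {f : List Bool → ℂ}
    (hf : ∀ w, 2 * Real.exp ((farey w).1 * α + (farey w).2 * β) ≤ ‖f w‖) :
    Summable fun w => 1 / ‖f w‖ ^ 2 := by
  have hgeo : ∀ {γ : ℝ}, 0 < γ → Summable fun n : ℕ => Real.exp (-(n * γ)) := by
    intro γ hγ
    have := Real.summable_exp_nat_mul_iff.2 (neg_lt_zero.2 hγ)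
    refine this.congr fun n => ?_
    rw [mul_neg]
  have h1 : Summable fun p : ℕ × ℕ => Real.exp (-(p.1 * α)) * Real.exp (-(p.2 * β)) :=
    (hgeo hα).mul_of_nonneg (hgeo hβ) (fun _ => (Real.exp_pos _).le) fun _ => (Real.exp_pos _).le
  refine Summable.of_nonneg_of_le (fun w => by positivity) (fun w => ?_)
    (h1.comp_injective farey_injective)
  simp only [Function.comp]
  rw [← Real.exp_add, ← neg_add, Real.exp_neg, one_div]
  set q := ((farey w).1 : ℝ) * α + (farey w).2 * β
  have hq : 0 ≤ q := by positivity
  have h2 := hf w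
  have h3 : 1 ≤ Real.exp q := Real.one_le_exp hq
  gcongr
  nlinarith

/-- Fibonacci growth of the values ahead of an edge that points away from the edge. -/
theorem Edge.growth (w : List Bool) {α β : ℝ} (hα : 0 < α) (hβ : 0 < β)
    (hx : 2 * Real.exp α ≤ ‖e.x‖) (hy : 2 * Real.exp β ≤ ‖e.y‖) (h : ‖e.back‖ ≤ ‖e.z‖) :
    2 * Real.exp ((farey w).1 * α + (farey w).2 * β) ≤ ‖(e.descend w).z‖ ∧
      ‖(e.descend w).back‖ ≤ ‖(e.descend w).z‖ := by
  have hz : ‖e.x‖ * ‖e.y‖ ≤ 2 * ‖e.z‖ := by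
    have h1 : e.x * e.y = e.back + e.z := by simp [Edge.back]
    have h2 := norm_add_le e.back e.z
    rw [← h1, norm_mul] at h2
    linarith
  have hα1 : 1 < Real.exp α := by simpa using hα
  have hβ1 : 1 < Real.exp β := by simpa using hβ
  have hz' : 2 * Real.exp (α + β) ≤ ‖e.z‖ := by
    rw [Real.exp_add]
    nlinarith [mul_le_mul hx hy (by positivity) (norm_nonneg _)]
  induction w generalizing e α β with
  | nil => simpa [farey] using ⟨hz', h⟩
  | cons s w ih =>
    cases s
    · have hg : ‖e.right.back‖ ≤ ‖e.right.z‖ := by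
        rw [Edge.back_right]
        have h1 : ‖e.z * e.y‖ ≤ ‖e.z * e.y - e.x‖ + ‖e.x‖ := by
          simpa using norm_add_le (e.z * e.y - e.x) e.x
        rw [norm_mul] at h1
        have h2 : 2 * ‖e.x‖ ≤ ‖e.z‖ * ‖e.y‖ := by
          have hy2 : 2 ≤ ‖e.y‖ := by linarith
          have hzx : ‖e.x‖ ≤ ‖e.z‖ := by nlinarith [norm_nonneg e.x]
          nlinarith [norm_nonneg e.z]
        change ‖e.x‖ ≤ ‖e.z * e.y - e.x‖
        linarith
      have hz2 : ‖e.right.x‖ * ‖e.right.y‖ ≤ 2 * ‖e.right.z‖ := by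
        have h1 : e.right.x * e.right.y = e.right.back + e.right.z := by simp [Edge.back]
        have h2 := norm_add_le e.right.back e.right.z
        rw [← h1, norm_mul] at h2
        linarith
      have hαβ : 1 < Real.exp (α + β) := by simpa using by linarith
      have := ih (e := e.right) (by linarith) hβ hz' hy hg hz2 hαβ hβ1 (by
        rw [Real.exp_add (α + β)]
        have := mul_le_mul hz' hy (by positivity) (norm_nonneg _)
        change _ ≤ ‖e.right.x‖ * ‖e.right.y‖ at this
        linarith)
      simp only [farey, Edge.descend_false]
      convert this using 4
      push_cast; ring
    · have hg : ‖e.left.back‖ ≤ ‖e.left.z‖ := by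
        rw [Edge.back_left]
        have h1 : ‖e.x * e.z‖ ≤ ‖e.x * e.z - e.y‖ + ‖e.y‖ := by
          simpa using norm_add_le (e.x * e.z - e.y) e.y
        rw [norm_mul] at h1
        have h2 : 2 * ‖e.y‖ ≤ ‖e.x‖ * ‖e.z‖ := by
          have hx2 : 2 ≤ ‖e.x‖ := by linarith
          have hzy : ‖e.y‖ ≤ ‖e.z‖ := by nlinarith [norm_nonneg e.y]
          nlinarith [norm_nonneg e.z]
        change ‖e.y‖ ≤ ‖e.x * e.z - e.y‖
        linarith
      have hz2 : ‖e.left.x‖ * ‖e.left.y‖ ≤ 2 * ‖e.left.z‖ := by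
        have h1 : e.left.x * e.left.y = e.left.back + e.left.z := by simp [Edge.back]
        have h2 := norm_add_le e.left.back e.left.z
        rw [← h1, norm_mul] at h2
        linarith
      have hαβ : 1 < Real.exp (α + β) := by simpa using by linarith
      have := ih (e := e.left) hα (by linarith) hx hz' hg hz2 hα1 hαβ (by
        rw [Real.exp_add α]
        have := mul_le_mul hx hz' (by positivity) (norm_nonneg _)
        change _ ≤ ‖e.left.x‖ * ‖e.left.y‖ at this
        linarith)
      simp only [farey, Edge.descend_true]
      convert this using 4
      push_cast; ring

theorem exists_exp_le {r : ℝ} (hr : 2 < r) : ∃ α : ℝ, 0 < α ∧ 2 * Real.exp α = r := by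
  refine ⟨Real.log (r / 2), Real.log_pos (by linarith), ?_⟩
  rw [Real.exp_log (by linarith)]; ring

theorem IsAdmissible.isFilled_of_growing_of_two_lt (h : IsAdmissible μ e) (hx : 2 < ‖e.x‖)
    (hy : 2 < ‖e.y‖) (hgrow : ‖e.back‖ ≤ ‖e.z‖) : IsFilled μ e := by
  obtain ⟨α, hα, hαx⟩ := exists_exp_le hx
  obtain ⟨β, hβ, hβy⟩ := exists_exp_le hy
  have hG := fun w => Edge.growth w hα hβ hαx.le hβy.le hgrow
  exact h.isFilled_of_growing (fun w => (hG w).2) (summable_of_farey_growth hα hβ fun w => (hG w).1)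

end PuncturedTorus

namespace PuncturedTorus

open Filter Topology

variable {μ : ℂ} {e : Edge}

/-! ### Descending paths -/

/-- Two consecutive edges that point backwards, with a small decrease on the first one, exist only
if `μ` is close to `4`. -/
theorem Edge.norm_sub_four_sq_le {M : ℝ} (hM : e.IsMarkoff μ) (hx : 2 < ‖e.x‖) (hz : 2 < ‖e.z‖)
    (hxM : ‖e.x‖ ≤ M) (hyM : ‖e.y‖ ≤ M) (hbM : ‖e.back‖ ≤ M) (h : ‖e.z‖ < ‖e.back‖)
    (h' : ‖e.left.z‖ < ‖e.left.back‖) :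
    ‖μ - 4‖ ^ 2 ≤ 8 * M * (M ^ 2 + (1 + M / 2) ^ 2) * (‖e.back‖ - ‖e.z‖) := by
  rw [Edge.back_left] at h'
  set b := e.back with hb
  set y' := e.left.z with hy'
  have hy'e : y' = e.x * e.z - e.y := rfl
  have hbe : b = e.x * e.y - e.z := rfl
  set d := ‖b‖ - ‖e.z‖ with hd
  have hd0 : 0 < d := by rw [hd]; linarith
  have hxz : ‖e.x‖ * ‖e.z‖ ≤ ‖e.y‖ + ‖y'‖ := by
    rw [← norm_mul, show e.x * e.z = e.y + y' by rw [hy'e]; ring]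
    exact norm_add_le _ _
  have hxy : ‖e.x‖ * ‖e.y‖ ≤ ‖e.z‖ + ‖b‖ := by
    rw [← norm_mul, show e.x * e.y = e.z + b by rw [hbe]; ring]
    exact norm_add_le _ _
  have hzy : ‖e.z‖ ≤ ‖e.y‖ := by nlinarith
  have hy0 := norm_nonneg e.y
  -- Since |z + b| = |x||y| ≥ 2|z|, the parallelogram law leaves |z − b|² ≤ 2(|b|² − |z|²).
  have h1 : ‖e.z - b‖ ^ 2 ≤ 4 * M * d := by
    have hp := parallelogram_law_with_norm ℝ e.z b
    rw [show e.z + b = e.x * e.y by rw [hbe]; ring, norm_mul] at hp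
    have h2 : 2 * ‖e.z‖ ≤ ‖e.x‖ * ‖e.y‖ := by nlinarith
    have h3 : (2 * ‖e.z‖) * (2 * ‖e.z‖) ≤ (‖e.x‖ * ‖e.y‖) * (‖e.x‖ * ‖e.y‖) :=
      mul_self_le_mul_self (by positivity) h2
    have h4 : 2 * (‖b‖ + ‖e.z‖) * d ≤ 4 * M * d := by
      apply mul_le_mul_of_nonneg_right _ hd0.le
      linarith
    rw [hd] at h4 ⊢
    nlinarith
  have h2 : ‖e.y - y'‖ ^ 2 ≤ 4 * M * d := by
    have hp := parallelogram_law_with_norm ℝ e.y y'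
    rw [show e.y + y' = e.x * e.z by rw [hy'e]; ring, norm_mul] at hp
    have h2 : 2 * ‖e.z‖ ≤ ‖e.x‖ * ‖e.z‖ := by nlinarith
    have h3 : (2 * ‖e.z‖) * (2 * ‖e.z‖) ≤ (‖e.x‖ * ‖e.z‖) * (‖e.x‖ * ‖e.z‖) :=
      mul_self_le_mul_self (by positivity) h2
    have h4 : 2 * (‖e.y‖ - ‖e.z‖) ≤ d := by
      have : 2 * ‖e.y‖ ≤ ‖e.x‖ * ‖e.y‖ := by nlinarith
      rw [hd]; linarith
    have h5 : 4 * (‖e.y‖ - ‖e.z‖) * (‖e.y‖ + ‖e.z‖) ≤ 2 * d * (2 * M) := by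
      apply mul_le_mul (by linarith) (by linarith) (by positivity) (by positivity)
    have h6 : ‖y'‖ * ‖y'‖ ≤ ‖e.y‖ * ‖e.y‖ := mul_self_le_mul_self (norm_nonneg _) h'.le
    nlinarith
  have h3 : ‖e.x ^ 2 - 4‖ * 2 ≤ M * ‖e.y - y'‖ + 2 * ‖e.z - b‖ := by
    have h4 : (e.x ^ 2 - 4) * e.z = -(e.x * (e.y - y') + 2 * (e.z - b)) := by
      rw [hy'e, hbe]; ring
    have h5 : ‖e.x ^ 2 - 4‖ * ‖e.z‖ ≤ ‖e.x‖ * ‖e.y - y'‖ + 2 * ‖e.z - b‖ := by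
      rw [← norm_mul, h4, norm_neg]
      refine (norm_add_le _ _).trans_eq ?_
      rw [norm_mul, norm_mul, Complex.norm_ofNat]
    have h6 : ‖e.x ^ 2 - 4‖ * 2 ≤ ‖e.x ^ 2 - 4‖ * ‖e.z‖ := by gcongr
    have h7 : ‖e.x‖ * ‖e.y - y'‖ ≤ M * ‖e.y - y'‖ := by gcongr
    linarith
  have h4 : ‖μ - 4‖ ≤ M * ‖e.y - y'‖ + (1 + M / 2) * ‖e.z - b‖ := by
    -- In the limiting case b = z, y' = y one has xy = 2z and xz = 2y, so x² = 4 and μ = 4; the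
    -- terms measure the deviation from it.
    have h5 : μ - 4 = (e.x ^ 2 - 4) + ((e.y - y') * e.y / 2 + (e.z - b) * e.z / 2) := by
      unfold Edge.IsMarkoff at hM
      rw [hy'e, hbe, ← hM]; ring
    have h6 : ‖(e.y - y') * e.y / 2‖ ≤ M / 2 * ‖e.y - y'‖ := by
      rw [norm_div, norm_mul, Complex.norm_ofNat]
      have := mul_le_mul_of_nonneg_left hyM (norm_nonneg (e.y - y'))
      linarith
    have h7 : ‖(e.z - b) * e.z / 2‖ ≤ M / 2 * ‖e.z - b‖ := by
      rw [norm_div, norm_mul, Complex.norm_ofNat]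
      have := mul_le_mul_of_nonneg_left (h.le.trans hbM) (norm_nonneg (e.z - b))
      linarith
    rw [h5]
    have h8 := norm_add_le (e.x ^ 2 - 4) ((e.y - y') * e.y / 2 + (e.z - b) * e.z / 2)
    have h9 := norm_add_le ((e.y - y') * e.y / 2) ((e.z - b) * e.z / 2)
    linarith
  have h5 : (M * ‖e.y - y'‖) ^ 2 ≤ M ^ 2 * (4 * M * d) := by
    rw [mul_pow]; gcongr
  have h6 : ((1 + M / 2) * ‖e.z - b‖) ^ 2 ≤ (1 + M / 2) ^ 2 * (4 * M * d) := by
    rw [mul_pow]; gcongr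
  have h7 : ‖μ - 4‖ ^ 2 ≤ (M * ‖e.y - y'‖ + (1 + M / 2) * ‖e.z - b‖) ^ 2 := by gcongr
  nlinarith [sq_nonneg (M * ‖e.y - y'‖ - (1 + M / 2) * ‖e.z - b‖)]

/-- An edge with large values whose gap is not filled. -/
structure IsUnfilled (μ : ℂ) (e : Edge) : Prop where
  isAdmissible : IsAdmissible μ e
  left_large : 2 < ‖e.x‖
  right_large : 2 < ‖e.y‖
  head_large : ∀ w, 2 < ‖(e.descend w).z‖
  not_isFilled : ¬ IsFilled μ e

theorem IsUnfilled.lt_norm_back (h : IsUnfilled μ e) : ‖e.z‖ < ‖e.back‖ := by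
  by_contra hle
  exact h.not_isFilled
    (h.isAdmissible.isFilled_of_growing_of_two_lt h.left_large h.right_large (not_lt.1 hle))

theorem IsUnfilled.exists_next (h : IsUnfilled μ e) :
    ∃ e', (e' = e.left ∨ e' = e.right) ∧ IsUnfilled μ e' := by
  by_cases hl : IsFilled μ e.left
  · refine ⟨e.right, Or.inr rfl, h.isAdmissible.right, h.head_large [], h.right_large,
      fun w => h.head_large (false :: w), fun hr => ?_⟩
    exact h.not_isFilled (h.isAdmissible.isFilled hl hr)
  · exact ⟨e.left, Or.inl rfl, h.isAdmissible.left, h.left_large, h.head_large [],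
      fun w => h.head_large (true :: w), hl⟩

theorem not_isUnfilled (hμ : μ ≠ 4) : ¬ IsUnfilled μ e := by
  intro h0
  choose next hnext hnext' using fun E : {E : Edge // IsUnfilled μ E} => E.2.exists_next
  let step : {E : Edge // IsUnfilled μ E} → {E : Edge // IsUnfilled μ E} :=
    fun E => ⟨next E, hnext' E⟩
  -- These are the three regions at the tail of the edge. Either turn replaces `back` by `z` among
  -- them.
  let S : Edge → ℝ := fun E => ‖E.x‖ + ‖E.y‖ + ‖E.back‖
  have hstep : ∀ E, S (step E).1 = S E.1 - (‖E.1.back‖ - ‖E.1.z‖) := by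
    intro E
    change S (next E) = _
    rcases hnext E with h | h
    · rw [h]
      simp only [S, Edge.back_left]
      simp only [Edge.left]
      ring
    · rw [h]
      simp only [S, Edge.back_right]
      simp only [Edge.right]
      ring
  set M := S e with hMdef
  have hM0 : 0 < M := by
    have h1 := h0.left_large
    have h2 := norm_nonneg e.y
    have h3 := norm_nonneg e.back
    simp only [hMdef, S]
    linarith
  have hbound : ∀ E : {E : Edge // IsUnfilled μ E}, S E.1 ≤ M →
      ‖μ - 4‖ ^ 2 ≤ 8 * M * (M ^ 2 + (1 + M / 2) ^ 2) * (‖E.1.back‖ - ‖E.1.z‖) := by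
    rintro ⟨E, hE⟩ hSM
    have h1 := norm_nonneg E.x
    have h2 := norm_nonneg E.y
    have h3 := norm_nonneg E.back
    simp only [S] at hSM
    have hn := (hnext' ⟨E, hE⟩).lt_norm_back
    rcases hnext ⟨E, hE⟩ with h | h <;> rw [h] at hn
    · exact Edge.norm_sub_four_sq_le hE.isAdmissible.isMarkoff hE.left_large (hE.head_large [])
        (by linarith) (by linarith) (by linarith) hE.lt_norm_back hn
    · have hb := hE.lt_norm_back
      have := Edge.norm_sub_four_sq_le (e := E.swap) (M := M) hE.isAdmissible.isMarkoff.swap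
        hE.right_large (hE.head_large []) (by simp only [Edge.swap]; linarith)
        (by simp only [Edge.swap]; linarith) (by rw [Edge.back_swap]; linarith)
        (by rw [Edge.back_swap]; exact hb)
        (by rw [Edge.left_swap, Edge.back_swap]; exact hn)
      rwa [Edge.back_swap] at this
  set K := 8 * M * (M ^ 2 + (1 + M / 2) ^ 2)
  have hK : 0 < K := by positivity
  have hc : 0 < ‖μ - 4‖ ^ 2 / K := by
    have : 0 < ‖μ - 4‖ := norm_pos_iff.2 (sub_ne_zero.2 hμ)
    positivity
  have hiter : ∀ n : ℕ, S (step^[n] ⟨e, h0⟩).1 ≤ M - n * (‖μ - 4‖ ^ 2 / K) := by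
    intro n
    induction n with
    | zero => simp [hMdef]
    | succ n ih =>
      rw [Function.iterate_succ_apply', hstep]
      have hle : S (step^[n] ⟨e, h0⟩).1 ≤ M := by
        refine ih.trans ?_
        have : 0 ≤ (n : ℝ) * (‖μ - 4‖ ^ 2 / K) := by positivity
        linarith
      have h1 := hbound _ hle
      have h2 : ‖μ - 4‖ ^ 2 / K ≤
          ‖(step^[n] ⟨e, h0⟩).1.back‖ - ‖(step^[n] ⟨e, h0⟩).1.z‖ := by
        rw [div_le_iff₀ hK]; linarith
      push_cast
      linarith
  obtain ⟨n, hn⟩ := exists_nat_gt (M / (‖μ - 4‖ ^ 2 / K))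
  rw [div_lt_iff₀ hc] at hn
  have h1 := hiter n
  have h2 : 0 ≤ S (step^[n] ⟨e, h0⟩).1 := by positivity
  linarith

theorem IsAdmissible.isFilled_of_two_lt (h : IsAdmissible μ e) (hμ : μ ≠ 4) (hx : 2 < ‖e.x‖)
    (hy : 2 < ‖e.y‖) (hz : ∀ w, 2 < ‖(e.descend w).z‖) : IsFilled μ e := by
  by_contra hF
  exact not_isUnfilled hμ ⟨h, hx, hy, hz, hF⟩

/-! ### The neighbours of a fixed region -/

theorem NonElliptic.exists_roots {x : ℂ} (hx : NonElliptic x) :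
    ∃ l m : ℂ, l + m = x ∧ l * m = 1 ∧ 1 < ‖l‖ ∧ ‖m‖ < 1 := by
  have hs := hx.rootFactor_re_pos
  have hs2 := rootFactor_sq x
  have hx0 := hx.ne_zero
  set s := rootFactor x
  have hprod : (x * (1 + s) / 2) * (x * (1 - s) / 2) = 1 := by
    have : (x * (1 + s) / 2) * (x * (1 - s) / 2) = x ^ 2 * (1 - s ^ 2) / 4 := by ring
    rw [this, hs2]
    field_simp
    ring
  have hlt : ‖x * (1 - s) / 2‖ < ‖x * (1 + s) / 2‖ := by
    rw [norm_div, norm_div, norm_mul, norm_mul]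
    have h1 : ‖1 - s‖ < ‖1 + s‖ := by
      apply lt_of_pow_lt_pow_left₀ 2 (norm_nonneg _)
      rw [← Complex.normSq_eq_norm_sq, ← Complex.normSq_eq_norm_sq, Complex.normSq_apply,
        Complex.normSq_apply]
      simp only [Complex.sub_re, Complex.sub_im, Complex.add_re, Complex.add_im, Complex.one_re,
        Complex.one_im]
      nlinarith
    have h2 : 0 < ‖x‖ := norm_pos_iff.2 hx0
    have h3 : (0 : ℝ) < ‖(2 : ℂ)‖ := by simp
    gcongr
  have hnorm : ‖x * (1 + s) / 2‖ * ‖x * (1 - s) / 2‖ = 1 := by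
    rw [← norm_mul, hprod, norm_one]
  have h0 := norm_nonneg (x * (1 - s) / 2)
  refine ⟨x * (1 + s) / 2, x * (1 - s) / 2, by ring, hprod, ?_, ?_⟩ <;> nlinarith

theorem Edge.iterate_left_x (e : Edge) (k : ℕ) : (Edge.left^[k] e).x = e.x := by
  induction k generalizing e with
  | zero => rfl
  | succ k ih => rw [Function.iterate_succ_apply, ih]; rfl

theorem Edge.iterate_left_succ_y (e : Edge) (k : ℕ) :
    (Edge.left^[k + 1] e).y = (Edge.left^[k] e).z := by
  rw [Function.iterate_succ_apply']; rfl

theorem Edge.descend_replicate_true (e : Edge) (k : ℕ) (w : List Bool) :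
    e.descend (List.replicate k true ++ w) = (Edge.left^[k] e).descend w := by
  induction k generalizing e with
  | zero => rfl
  | succ k ih => rw [Function.iterate_succ_apply, ← ih]; rfl

theorem Edge.iterate_left_y {l m : ℂ} (hadd : l + m = e.x) (hmul : l * m = 1) (k : ℕ) :
    (l - m) * (Edge.left^[k] e).y = (e.z - m * e.y) * l ^ k - (e.z - l * e.y) * m ^ k := by
  induction k generalizing e with
  | zero => simp; ring
  | succ k ih =>
    rw [Function.iterate_succ_apply, ih (e := e.left) hadd]
    simp only [Edge.left, ← hadd]
    rw [pow_succ, pow_succ]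
    linear_combination (e.y * l ^ k - e.y * m ^ k) * hmul

/-- This is the coefficient of l ^ k in `Edge.iterate_left_y`; without it only the decaying term m ^
k remains, and the neighbours would tend to zero. -/
theorem Edge.head_sub_ne_zero {l m : ℂ} (hadd : l + m = e.x) (hmul : l * m = 1) (hl : 1 < ‖l‖)
    (hm : ‖m‖ < 1) (hlarge : ∀ᶠ k in atTop, 2 < ‖(Edge.left^[k] e).y‖) : e.z - m * e.y ≠ 0 := by
  intro h0
  have hlm : l - m ≠ 0 := by
    intro h
    rw [sub_eq_zero.1 h] at hl
    linarith
  have h1 : Tendsto (fun k => (l - m) * (Edge.left^[k] e).y) atTop (𝓝 0) := by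
    have h2 : Tendsto (fun k : ℕ => -((e.z - l * e.y) * m ^ k)) atTop (𝓝 0) := by
      simpa using ((tendsto_pow_atTop_nhds_zero_of_norm_lt_one hm).const_mul
        (e.z - l * e.y)).neg
    refine h2.congr fun k => ?_
    rw [Edge.iterate_left_y hadd hmul, h0]
    ring
  have h3 : ∀ᶠ k in atTop, ‖(l - m) * (Edge.left^[k] e).y‖ < ‖l - m‖ * 2 := by
    have := h1.norm
    rw [norm_zero] at this
    exact this.eventually (gt_mem_nhds (by have := norm_pos_iff.2 hlm; positivity))
  obtain ⟨k, hk1, hk2⟩ := (hlarge.and h3).exists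
  rw [norm_mul] at hk2
  have := norm_pos_iff.2 hlm
  nlinarith

theorem Edge.exists_ratio (hx : NonElliptic e.x)
    (hlarge : ∀ᶠ k in atTop, 2 < ‖(Edge.left^[k] e).y‖) : ∃ r : ℝ, 1 < r ∧ ∀ᶠ k in atTop,
      r * ‖(Edge.left^[k] e).y‖ ≤ ‖(Edge.left^[k] e).z‖ := by
  obtain ⟨l, m, hadd, hmul, hl, hm⟩ := hx.exists_roots
  have hu := Edge.head_sub_ne_zero hadd hmul hl hm hlarge
  set u := e.z - m * e.y
  set v := e.z - l * e.y with hv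
  have hupos := norm_pos_iff.2 hu
  have hlm : 0 < ‖l - m‖ := by
    apply norm_pos_iff.2
    intro h
    rw [sub_eq_zero.1 h] at hl
    linarith
  -- Any ratio strictly between 1 and |l| would do; l ^ k dominates eventually.
  set r := (1 + ‖l‖) / 2 with hr
  have hlr : 0 < ‖l‖ - r := by rw [hr]; linarith
  refine ⟨r, by rw [hr]; linarith, ?_⟩
  filter_upwards [(tendsto_pow_atTop_atTop_of_one_lt hl).eventually_ge_atTop
    (‖v‖ * (r + 1) / (‖u‖ * (‖l‖ - r)))] with k hk
  rw [div_le_iff₀ (by positivity)] at hk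
  have h1 : ‖l - m‖ * ‖(Edge.left^[k] e).y‖ ≤ ‖u‖ * ‖l‖ ^ k + ‖v‖ * ‖m‖ ^ k := by
    rw [← norm_mul, Edge.iterate_left_y hadd hmul]
    refine (norm_sub_le _ _).trans_eq ?_
    rw [norm_mul, norm_mul, norm_pow, norm_pow]
  have h2 : ‖u‖ * ‖l‖ ^ (k + 1) - ‖v‖ * ‖m‖ ^ (k + 1) ≤ ‖l - m‖ * ‖(Edge.left^[k] e).z‖ := by
    rw [← norm_mul, ← Edge.iterate_left_succ_y, Edge.iterate_left_y hadd hmul]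
    refine le_trans (le_of_eq ?_) (norm_sub_norm_le _ _)
    rw [norm_mul, norm_mul, norm_pow, norm_pow]
  have hmk : ‖m‖ ^ k ≤ 1 := pow_le_one₀ (norm_nonneg _) hm.le
  have hmk1 : ‖m‖ ^ (k + 1) ≤ 1 := pow_le_one₀ (norm_nonneg _) hm.le
  have hv1 : ‖v‖ * ‖m‖ ^ k ≤ ‖v‖ := mul_le_of_le_one_right (norm_nonneg _) hmk
  have hv2 : ‖v‖ * ‖m‖ ^ (k + 1) ≤ ‖v‖ := mul_le_of_le_one_right (norm_nonneg _) hmk1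
  have hr0 : 0 ≤ r := by rw [hr]; linarith
  have h3 : r * (‖l - m‖ * ‖(Edge.left^[k] e).y‖) ≤ r * (‖u‖ * ‖l‖ ^ k + ‖v‖) :=
    mul_le_mul_of_nonneg_left (by linarith) hr0
  rw [pow_succ] at h2
  have h4 : ‖l - m‖ * (r * ‖(Edge.left^[k] e).y‖) ≤ ‖l - m‖ * ‖(Edge.left^[k] e).z‖ := by
    nlinarith
  exact le_of_mul_le_mul_left h4 hlm

/-- Fibonacci growth ahead of an edge that is followed by exponential growth along the region on its
left. -/
theorem Edge.growth_of_ratio (w : List Bool) {α β : ℝ} (hα : 0 < α) (hβ : 0 < β)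
    (hx : ‖e.x‖ ≤ 2) (hy : 2 * Real.exp β ≤ ‖e.y‖) (hb : ‖e.back‖ ≤ ‖e.y‖)
    (h : ∀ k, Real.exp α * ‖(Edge.left^[k] e).y‖ ≤ ‖(Edge.left^[k] e).z‖) :
    2 * Real.exp ((farey w).1 * α + (farey w).2 * β) ≤ ‖(e.descend w).z‖ ∧
      ‖(e.descend w).back‖ ≤ ‖(e.descend w).z‖ := by
  have hα1 : 1 < Real.exp α := by simpa using hα
  have h0 := h 0
  simp only [Function.iterate_zero, id] at h0
  have hyz : ‖e.y‖ ≤ ‖e.z‖ := by nlinarith [norm_nonneg e.y]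
  have hz : 2 * Real.exp (α + β) ≤ ‖e.z‖ := by
    rw [Real.exp_add]
    nlinarith
  induction w generalizing e β with
  | nil =>
    refine ⟨by simpa [farey] using hz, ?_⟩
    exact hb.trans hyz
  | cons s w ih =>
    cases s
    · have hβ1 : 1 < Real.exp β := by simpa using hβ
      have hg : ‖e.right.back‖ ≤ ‖e.right.z‖ := by
        rw [Edge.back_right]
        have h1 : ‖e.z * e.y‖ ≤ ‖e.z * e.y - e.x‖ + ‖e.x‖ := by
          simpa using norm_add_le (e.z * e.y - e.x) e.x
        rw [norm_mul] at h1
        change ‖e.x‖ ≤ ‖e.z * e.y - e.x‖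
        nlinarith
      -- A right turn leaves the small region: both sides are now large and ordinary growth takes
      -- over.
      have := Edge.growth (e := e.right) w (by linarith : 0 < α + β) hβ hz hy hg
      simp only [farey, Edge.descend_false]
      convert this using 4
      push_cast; ring
    · have h1 := h 1
      have h1' : Real.exp α * ‖e.z‖ ≤ ‖e.left.z‖ := h1
      have := ih (e := e.left) (by linarith : 0 < α + β) hx hz (by rw [Edge.back_left]; exact hyz)
        (fun k => h (k + 1)) h1' (by change ‖e.z‖ ≤ _; nlinarith [norm_nonneg e.z]) (by
          rw [Real.exp_add α]
          nlinarith)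
      simp only [farey, Edge.descend_true]
      convert this using 4
      push_cast; ring

theorem IsAdmissible.isFilled_of_iterate_left (hμ : μ ≠ 4) (n : ℕ) (h : IsAdmissible μ e)
    (hy : 2 < ‖e.y‖) (hz : ∀ w, 2 < ‖(e.descend w).z‖) (hF : IsFilled μ (Edge.left^[n] e)) :
    IsFilled μ e := by
  induction n generalizing e with
  | zero => exact hF
  | succ n ih =>
    exact h.isFilled (ih h.left (hz []) (fun w => hz (true :: w)) hF)
      (h.right.isFilled_of_two_lt hμ (hz []) hy fun w => hz (false :: w))

theorem IsAdmissible.iterate_left (h : IsAdmissible μ e) (n : ℕ) :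
    IsAdmissible μ (Edge.left^[n] e) := by
  induction n generalizing e with
  | zero => exact h
  | succ n ih => exact ih h.left

/-- If the left region is small, its successive neighbours eventually grow by a fixed ratio, which
fills a late edge along it. The edges branching off to the right have two large sides and are
filled, so filling propagates back to e. -/
theorem IsAdmissible.isFilled_of_right_large (h : IsAdmissible μ e) (hμ : μ ≠ 4) (hy : 2 < ‖e.y‖)
    (hz : ∀ w, 2 < ‖(e.descend w).z‖) : IsFilled μ e := by
  rcases lt_or_ge 2 ‖e.x‖ with hx | hx
  · exact h.isFilled_of_two_lt hμ hx hy hz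
  have hzk : ∀ k, 2 < ‖(Edge.left^[k] e).z‖ := by
    intro k
    have := hz (List.replicate k true ++ [])
    rwa [Edge.descend_replicate_true] at this
  have hyk : ∀ k, 2 < ‖(Edge.left^[k] e).y‖ := by
    intro k
    cases k with
    | zero => exact hy
    | succ k => rw [Edge.iterate_left_succ_y]; exact hzk k
  obtain ⟨r, hr, hev⟩ := Edge.exists_ratio h.left_nonElliptic (Eventually.of_forall hyk)
  obtain ⟨n, hn⟩ := eventually_atTop.1 hev
  -- Starting one step past n ensures |back| ≤ |y|, which is the ratio inequality at n.
  apply h.isFilled_of_iterate_left hμ (n + 1) hy hz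
  set f := Edge.left^[n + 1] e with hf
  obtain ⟨β, hβ, hβy⟩ := exists_exp_le (hyk (n + 1))
  have hα := Real.log_pos hr
  have hG := fun w => Edge.growth_of_ratio (e := f) w hα hβ
    (by rw [hf, Edge.iterate_left_x]; exact hx) hβy.le
    (by
      have h1 := hn n le_rfl
      rw [hf, Edge.iterate_left_succ_y, Function.iterate_succ_apply', Edge.back_left]
      nlinarith [norm_nonneg (Edge.left^[n] e).y])
    (fun k => by
      rw [Real.exp_log (by linarith), hf, ← Function.iterate_add_apply]
      exact hn _ (by omega))
  exact (h.iterate_left _).isFilled_of_growing (fun w => (hG w).2)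
    (summable_of_farey_growth hα hβ fun w => (hG w).1)

theorem IsAdmissible.isFilled_of_left_large (h : IsAdmissible μ e) (hμ : μ ≠ 4) (hx : 2 < ‖e.x‖)
    (hz : ∀ w, 2 < ‖(e.descend w).z‖) : IsFilled μ e :=
  (h.swap.isFilled_of_right_large hμ hx fun w => by
    rw [Edge.descend_swap]; exact hz _).of_swap

/-- All but finitely many values ahead of the edge are large. -/
def IsEventuallyLarge (e : Edge) : Prop :=
  ∃ N, ∀ w : List Bool, N ≤ w.length → 2 < ‖(e.descend w).z‖

/-- Filling passes from both children to the parent. At depth bound 0 the sides of e may still be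
small, but each child has the head of e as a large side. -/
theorem IsAdmissible.isFilled_of_isEventuallyLarge (h : IsAdmissible μ e) (hμ : μ ≠ 4)
    (hL : IsEventuallyLarge e) : IsFilled μ e := by
  obtain ⟨N, hN⟩ := hL
  induction N generalizing e with
  | zero =>
    have hz : ∀ w, 2 < ‖(e.descend w).z‖ := fun w => hN w (Nat.zero_le _)
    exact h.isFilled
      (h.left.isFilled_of_right_large hμ (hz []) fun w => hz (true :: w))
      (h.right.isFilled_of_left_large hμ (hz []) fun w => hz (false :: w))
  | succ N ih =>
    exact h.isFilled (ih h.left fun w hw => hN (true :: w) (by simpa using hw))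
      (ih h.right fun w hw => hN (false :: w) (by simpa using hw))

/-! ### Finitely many small values, and the exclusion of x² = μ -/

theorem isEventuallyLarge_of_finite (h : {w | ‖(e.descend w).z‖ ≤ 2}.Finite) :
    IsEventuallyLarge e := by
  obtain ⟨N, hN⟩ := (h.image List.length).bddAbove
  refine ⟨N + 1, fun w hw => ?_⟩
  by_contra hle
  have := hN ⟨w, not_lt.1 hle, rfl⟩
  omega

theorem IsEventuallyLarge.descend (h : IsEventuallyLarge e) (w : List Bool) :
    IsEventuallyLarge (e.descend w) := by
  obtain ⟨N, hN⟩ := h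
  refine ⟨N, fun w' hw' => ?_⟩
  rw [← Edge.descend_append]
  exact hN _ (by simp; omega)

theorem IsEventuallyLarge.swap (h : IsEventuallyLarge e) : IsEventuallyLarge e.swap := by
  obtain ⟨N, hN⟩ := h
  refine ⟨N, fun w hw => ?_⟩
  rw [Edge.descend_swap]
  exact hN _ (by simpa using hw)

theorem IsEventuallyLarge.eventually_left (h : IsEventuallyLarge e) :
    ∀ᶠ k in atTop, 2 < ‖(Edge.left^[k] e).y‖ := by
  obtain ⟨N, hN⟩ := h
  filter_upwards [eventually_ge_atTop (N + 1)] with k hk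
  obtain ⟨k, rfl⟩ : ∃ j, k = j + 1 := ⟨k - 1, by omega⟩
  have := hN (List.replicate k true ++ []) (by simp; omega)
  rwa [Edge.descend_replicate_true, Edge.descend_nil, ← Edge.iterate_left_succ_y] at this

/-- With l + m = x and lm = 1, the Markoff equation reads x² − μ = (z − my)(back − my). Up to the
factor l − m, these are the leading coefficients of the neighbours of x in the two directions. -/
theorem Edge.IsMarkoff.sq_ne (hM : e.IsMarkoff μ) (hx : NonElliptic e.x)
    (h : ∀ᶠ k in atTop, 2 < ‖(Edge.left^[k] e).y‖)
    (h' : ∀ᶠ k in atTop, 2 < ‖(Edge.left^[k] e.reverse).y‖) : e.x ^ 2 ≠ μ := by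
  obtain ⟨l, m, hadd, hmul, hl, hm⟩ := hx.exists_roots
  have h1 := Edge.head_sub_ne_zero hadd hmul hl hm h
  have h2 := Edge.head_sub_ne_zero (e := e.reverse) hadd hmul hl hm h'
  simp only [Edge.reverse, Edge.back] at h2
  rw [← sub_ne_zero]
  convert mul_ne_zero h1 h2 using 1
  unfold Edge.IsMarkoff at hM
  rw [← hM, ← hadd]
  linear_combination e.y ^ 2 * hmul

/-- The head of f is the left side of `f.right`. Its neighbours in one direction come from left
turns there; in the other, after one step, from the mirror image of `f.left`. -/
theorem Edge.IsMarkoff.head_sq_ne (hM : e.IsMarkoff μ) (hL : IsEventuallyLarge e)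
    (hz : ∀ w, NonElliptic (e.descend w).z) (w : List Bool) : (e.descend w).z ^ 2 ≠ μ := by
  set f := e.descend w with hf
  have hMf : f.IsMarkoff μ := hM.descend w
  have hLf : IsEventuallyLarge f := hL.descend w
  refine hMf.right.sq_ne (hz w) (hLf.descend [false]).eventually_left ?_
  have h1 := (hLf.descend [true]).swap.eventually_left
  filter_upwards [(tendsto_sub_atTop_nat 1).eventually h1, eventually_ge_atTop 1] with k hk hk1
  obtain ⟨k, rfl⟩ : ∃ j, k = j + 1 := ⟨k - 1, by omega⟩
  rw [Nat.add_sub_cancel] at hk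
  have : f.right.reverse.left = (f.descend [true]).swap := by
    simp [Edge.right, Edge.reverse, Edge.left, Edge.back, Edge.swap, mul_comm]
  rwa [Function.iterate_succ_apply, this]

/-- The identity for the values at the vertices of the tree. -/
theorem hasSum_of_isEventuallyLarge (hμ : μ ≠ 4) (hM : e.IsMarkoff μ) (hx : NonElliptic e.x)
    (hy : NonElliptic e.y) (hz : ∀ w, NonElliptic (e.descend w).z)
    (hz' : ∀ w, NonElliptic (e.reverse.descend w).z)
    (hL : IsEventuallyLarge e) (hL' : IsEventuallyLarge e.reverse)
    {v : Bool ⊕ (List Bool ⊕ List Bool) → ℂ}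
    (hv : v = Sum.elim (fun s => cond s e.x e.y)
      (Sum.elim (fun w => (e.descend w).z) fun w => (e.reverse.descend w).z)) :
    (∀ i, v i ^ 2 ≠ μ) ∧ HasSum (fun i => hMu μ (v i)) (1 / 2) := by
  subst hv
  have hxμ : e.x ^ 2 ≠ μ := hM.sq_ne hx hL.eventually_left hL'.eventually_left
  have hyμ : e.y ^ 2 ≠ μ := by
    refine hM.swap.sq_ne hy hL.swap.eventually_left ?_
    have : e.swap.reverse = e.reverse.swap := by
      simp [Edge.swap, Edge.reverse, Edge.back, mul_comm]
    rw [this]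
    exact hL'.swap.eventually_left
  have hzμ := hM.head_sq_ne hL hz
  have hzμ' := hM.reverse.head_sq_ne hL' hz'
  have hF : IsFilled μ e := IsAdmissible.isFilled_of_isEventuallyLarge
    ⟨hM, hx, hy, hz, hxμ, hyμ, hzμ⟩ hμ hL
  have hF' : IsFilled μ e.reverse := IsAdmissible.isFilled_of_isEventuallyLarge
    ⟨hM.reverse, hx, hy, hz', hxμ, hyμ, hzμ'⟩ hμ hL'
  refine ⟨?_, ?_⟩
  · rintro ((_ | _) | w | w)
    exacts [hyμ, hxμ, hzμ w, hzμ' w]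
  · have h1 := HasSum.sum (f := fun i : Bool ⊕ (List Bool ⊕ List Bool) =>
      2 * hMu μ (Sum.elim (fun s => cond s e.x e.y)
        (Sum.elim (fun w => (e.descend w).z) fun w => (e.reverse.descend w).z) i))
      (hasSum_fintype _) (HasSum.sum hF hF')
    -- The two gaps together with 2h(x) + 2h(y) make 1; halving removes the factor 2 built into
    -- `IsFilled`.
    have h2 := h1.mul_left (1 / 2 : ℂ)
    rw [gap_add_gap_reverse hx.ne_zero hy.ne_zero hxμ hyμ] at h2
    rw [Fintype.sum_bool] at h2
    have h3 : (1 / 2 : ℂ) * ((2 * hMu μ e.x + 2 * hMu μ e.y) +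
        (1 - 2 * hMu μ e.x - 2 * hMu μ e.y)) = 1 / 2 := by ring
    rw [← h3]
    exact (congrArg (fun f => HasSum f _) (funext fun i => by ring)).mp h2

end PuncturedTorus

/-! ### From the tree back to the curves -/

namespace PuncturedTorus

variable {π : Type*} [Group π] (b : FreeGroupBasis (Fin 2) π) (ρ : π →* SL(2, ℂ))

theorem curveTrace_treeCurve (i : Bool ⊕ (List Bool ⊕ List Bool)) :
    curveTrace ρ (treeCurve b i) = Sum.elim
      (fun s => cond s (traceEdge ρ (b 0) (b 1)).x (traceEdge ρ (b 0) (b 1)).y)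
      (Sum.elim (fun w => ((traceEdge ρ (b 0) (b 1)).descend w).z)
        fun w => ((traceEdge ρ (b 0) (b 1)).reverse.descend w).z) i := by
  change elementTrace ρ (treeElement b i) = _
  rcases i with (_ | _) | w | w
  · rfl
  · rfl
  · exact elementTrace_pairHead ρ (b 0) (b 1) w
  · rw [treeElement, elementTrace_pairHead, traceEdge_inv_right]
    rfl

end PuncturedTorus

theorem theorem1p1 {π : Type*} [Group π] (b : FreeGroupBasis (Fin 2) π)
    (ρ : π →* Matrix.SpecialLinearGroup (Fin 2) ℂ)
    (hirr : PuncturedTorus.IsIrred ρ) (hB : PuncturedTorus.BowditchConditions ρ)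
    (μ : ℂ) (hμ : μ = PuncturedTorus.peripheralTrace ρ b + 2) :
    (∀ X : PuncturedTorus.Curves π, PuncturedTorus.curveTrace ρ X ^ 2 ≠ μ) ∧
    Summable (fun X : PuncturedTorus.Curves π => ‖hMu μ (PuncturedTorus.curveTrace ρ X)‖) ∧
    HasSum (fun X : PuncturedTorus.Curves π => hMu μ (PuncturedTorus.curveTrace ρ X)) (1 / 2) ∧
    (μ = 0 → HasSum (fun X : PuncturedTorus.Curves π =>
      1 / 2 * (1 - csqrt (1 - 4 / PuncturedTorus.curveTrace ρ X ^ 2))) (1 / 2)) := by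
  open PuncturedTorus in
  have hμ4 : μ ≠ 4 := by
    intro h
    apply peripheralTrace_ne_two b hirr
    linear_combination h - hμ
  have hM : (traceEdge ρ (b 0) (b 1)).IsMarkoff μ := hμ ▸ isMarkoff_traceEdge ρ (b 0) (b 1)
  have hne : ∀ i, NonElliptic (curveTrace ρ (treeCurve b i)) := fun i => hB.trace_notMem _
  have hfin : {i | ‖curveTrace ρ (treeCurve b i)‖ ≤ 2}.Finite :=
    hB.finite_small.preimage (treeCurve_injective b).injOn
  have htree := curveTrace_treeCurve b ρ
  have hfin1 : {w | ‖((traceEdge ρ (b 0) (b 1)).descend w).z‖ ≤ 2}.Finite := by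
    convert hfin.preimage (f := fun w => Sum.inr (Sum.inl w))
      (Sum.inr_injective.comp Sum.inl_injective).injOn using 1
    ext w
    simp [htree]
  have hfin2 : {w | ‖((traceEdge ρ (b 0) (b 1)).reverse.descend w).z‖ ≤ 2}.Finite := by
    convert hfin.preimage (f := fun w => Sum.inr (Sum.inr w))
      (Sum.inr_injective.comp Sum.inr_injective).injOn using 1
    ext w
    simp [htree]
  simp only [htree] at hne
  obtain ⟨hsq, hsum⟩ := hasSum_of_isEventuallyLarge hμ4 hM (hne (.inl true)) (hne (.inl false))
    (fun w => hne (.inr (.inl w))) (fun w => hne (.inr (.inr w)))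
    (isEventuallyLarge_of_finite hfin1) (isEventuallyLarge_of_finite hfin2) (funext htree)
  have hsum' : HasSum (fun X : Curves π => hMu μ (curveTrace ρ X)) (1 / 2) :=
    (Equiv.ofBijective _ (treeCurve_bijective b)).hasSum_iff.1 hsum
  refine ⟨fun X => ?_, hsum'.summable.norm, hsum', fun h0 => ?_⟩
  · obtain ⟨i, rfl⟩ := treeCurve_surjective b X
    exact hsq i
  · convert hsum' using 2 with X
    have hX : curveTrace ρ X ^ 2 ≠ 0 :=
      pow_ne_zero 2 (NonElliptic.ne_zero (hB.trace_notMem X))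
    simp [hMu, h0, div_self hX]
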